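/- Let $X=[0,1]$, let $\delta>1$, and let $c:X\to\mathbb{R}_+$ be differentiable (one-sidedly at the end points), strictly increasing and strictly convex with $c(0)=0$ and $c'(0)>0$. Let $g:\{1,2,\dots\}\to\mathbb{R}_+$ be strictly increasing with $g(1)=0$ and $g(k)\to\infty$ as $k\to\infty$. For $\lambda\ge 0$ let $f(k;\lambda)=\lambda^{k-1}e^{-\lambda}/(k-1)!$, $k\ge1$ (with $0^0=1$, so that $f(1;0)=1$), be the Poisson law with parameter $\lambda$ shifted to start from $k=1$, and write $\mathbb{E}^\lambda_k[\varphi(k)]=\sum_{k=1}^\infty\varphi(k)f(k;\lambda)$ (possibly $+\infty$). For continuous $p:X\to\mathbb{R}_+$ put $$\tilde Tp(s)=\min_{0\le t\le s,\ \lambda\ge 0}\bigl\{c(s-t)+\mathbb{E}^\lambda_k[g(k)+\delta k\,p(t/k)]\bigr\},\qquad s\in X.$$ Let $[u_0,v_0]$ be the set of continuous $p:X\to\mathbb{R}$ with $c'(0)s\le p(s)\le c(s)$ for all $s\in X$. For $n\ge 0$ let $h_n=2^{-n}$ and let $\tilde p_n:X\to\mathbb{R}$ be the function that is affine on each interval $[jh_n,(j+1)h_n]$,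 $0\le j<2^n$, and whose grid values are determined recursively by $\tilde p_n(0)=0$ and $$\tilde p_n(s)=\min_{0\le t\le s-h_n,\ \lambda\ge 0}\bigl\{c(s-t)+\mathbb{E}^\lambda_k[g(k)+\delta k\,\tilde p_n(t/k)]\bigr\},\qquad s=h_n,2h_n,\dots,1.$$ Then the minima defining $\tilde Tp$ for $p\in[u_0,v_0]$ and those defining $\tilde p_n$ are attained, $\tilde T$ maps $[u_0,v_0]$ into itself, and $\tilde T$ has a unique fixed point $\tilde p^*$ in $[u_0,v_0]$. For every $p\in[u_0,v_0]$, $\tilde T^n p\to\tilde p^*$ uniformly on $X$ as $n\to\infty$. Furthermore, $\tilde p_n\to\tilde p^*$ uniformly on $X$. -/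

import Mathlib

open Set Filter Topology
open scoped unitInterval Nat

noncomputable section

/-- The cost function `c`, on the stages `[0, 1]`: differentiable (one-sidedly at the end points),
strictly increasing, strictly convex, `c 0 = 0`, `c' 0 > 0`. Only its values on `[0, 1]` matter. -/
structure CostAssumption (c : ℝ → ℝ) : Prop where
  differentiableOn : DifferentiableOn ℝ c (Icc 0 1)
  strictMonoOn : StrictMonoOn c (Icc 0 1)
  strictConvexOn : StrictConvexOn ℝ (Icc 0 1) c
  map_zero : c 0 = 0
  deriv_zero_pos : 0 < derivWithin c (Icc 0 1) 0

/-- The additive transaction cost `g`, a function of the number `k = 1, 2, …` of partners. -/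
structure TransactionAssumption (g : ℕ+ → ℝ) : Prop where
  strictMono : StrictMono g
  map_one : g 1 = 0
  tendsto : Tendsto g atTop atTop

/-- The share `t / k` of each of `k` partners. -/
def share (t : I) (k : ℕ+) : I :=
  ⟨(t : ℝ) / (k : ℕ), div_nonneg t.2.1 (Nat.cast_nonneg _),
    div_le_one_of_le₀ (t.2.2.trans (Nat.one_le_cast.2 k.pos)) (Nat.cast_nonneg _)⟩

/-- The Poisson probability of `k` shifted to start from `k = 1`. For `l = 0` it is the point mass
at `k = 1`, since `0 ^ 0 = 1`. -/
def shiftedPoisson (l : ℝ) (k : ℕ+) : ℝ :=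
  l ^ ((k : ℕ) - 1) * Real.exp (-l) / (((k : ℕ) - 1)! : ℕ)

/-- The finite values of `c (s - t) + E_k^l [g k + δ k p (t / k)]` over `0 ≤ t ≤ r`, `l ≥ 0`.
If `g` grows fast the expectation may be `+∞` for some `l > 0`; such `l` are never optimal
(`l = 0` always has finite cost) and contribute no element. -/
def costValues (c : ℝ → ℝ) (g : ℕ+ → ℝ) (δ : ℝ) (p : I → ℝ) (s r : ℝ) : Set ℝ :=
  {x | ∃ t : I, (t : ℝ) ≤ r ∧ ∃ l : ℝ, 0 ≤ l ∧ ∃ e : ℝ,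
    HasSum (fun k : ℕ+ => (g k + δ * (k : ℕ) * p (share t k)) * shiftedPoisson l k) e ∧
    x = c (s - t) + e}

/-- The operator of the stochastic model: the minimal cost over `t ≤ s` and `l ≥ 0`. -/
def stochT (c : ℝ → ℝ) (g : ℕ+ → ℝ) (δ : ℝ) (p : I → ℝ) : I → ℝ :=
  fun s => sInf (costValues c g δ p s s)

/-- The order interval `[u₀, v₀]` of `C([0, 1])`, with `u₀ s = c'(0) s` and `v₀ s = c s`. -/
def orderInterval (c : ℝ → ℝ) : Set C(I, ℝ) :=
  {p | ∀ s : I, derivWithin c (Icc 0 1) 0 * s ≤ p s ∧ p s ≤ c s}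

/-- The grid point `j h`, `h = 1 / m`, as a point of `[0, 1]` (for `j ≤ m`). -/
def gridPoint (m j : ℕ) : I := projIcc 0 1 zero_le_one ((j : ℝ) / m)

/-- The price function after `j` passes of the loop of the grid algorithm with step `h = 1 / m`;
it is meaningful on `[0, j h]`. Pass `j + 1` computes the price at `(j + 1) h` as the minimal
cost over `t ≤ j h`, `l ≥ 0`, and extends the price linearly from `j h` to `(j + 1) h`. -/
def algState (c : ℝ → ℝ) (g : ℕ+ → ℝ) (δ : ℝ) (m : ℕ) : ℕ → I → ℝ
  | 0 => fun _ => 0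
  | j + 1 => fun x =>
      if (x : ℝ) ≤ (j : ℝ) / m then algState c g δ m j x
      else algState c g δ m j (gridPoint m j) + ((x : ℝ) * m - j) *
        (sInf (costValues c g δ (algState c g δ m j) (((j : ℝ) + 1) / m) ((j : ℝ) / m))
          - algState c g δ m j (gridPoint m j))

/-- The output of the grid algorithm with step `h = 1 / m`. -/
def gridAlgorithm (c : ℝ → ℝ) (g : ℕ+ → ℝ) (δ : ℝ) (m : ℕ) : I → ℝ :=
  algState c g δ m m

end

/-! ### The cost function -/

namespace CostAssumption

variable {c : ℝ → ℝ}

/-! Write T for `stochT`, a = c'(0), b = c'(1), u₀ s = a s and v₀ s = c s. Everything rests on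
order. T is monotone and concave on [u₀, v₀]: for fixed t and λ the expected cost is affine in the
price, and T is a minimum of such functions. Moreover T v₀ ≤ v₀, and because δ > 1 there is ε > 0
with T u₀ ≥ u₀ + ε (v₀ - u₀). Induction then gives T^n q ≥ (1 - ρ^n) T^n p + ρ^n u₀ with ρ = 1 - ε,
for any two admissible p and q, hence |T^n p - T^n q| ≤ ρ^n c(1)
(`exists_abs_stochT_iterate_sub_le`). Uniqueness and uniform convergence follow at once, and the
decreasing limit of T^n v₀ is a fixed point.

Attainment comes from lower semicontinuity in (t, λ), with λ confined to a compact interval because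
g tends to infinity. Continuity of T p needs the functions t ↦ k p(t/k) to be equicontinuous in k.
This holds because p(x)/x, squeezed between a and c(x)/x, extends continuously to 0.

The grid output G_m is treated as an approximate fixed point. For each fixed n and η > 0 and all
large m, T^n u₀ ≤ (1 + η) G_m and G_m ≤ (1 + η) T^n v₀ (`GridLowerBound.stochT`,
`GridUpperBound.stochT`), by induction on n. Errors are kept multiplicative because raising prices
by a factor A ≥ 1 raises costs by at most A. Letting first m and then n grow squeezes G_m onto the
fixed point. -/

theorem continuousOn (hc : CostAssumption c) : ContinuousOn c (Icc 0 1) :=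
  hc.differentiableOn.continuousOn

theorem mono (hc : CostAssumption c) {x y : ℝ} (hx : 0 ≤ x) (hxy : x ≤ y) (hy : y ≤ 1) :
    c x ≤ c y :=
  hc.strictMonoOn.monotoneOn ⟨hx, hxy.trans hy⟩ ⟨hx.trans hxy, hy⟩ hxy

theorem nonneg (hc : CostAssumption c) {x : ℝ} (hx : 0 ≤ x) (hx1 : x ≤ 1) : 0 ≤ c x :=
  hc.map_zero ▸ hc.mono le_rfl hx hx1

theorem marginal_mul_le (hc : CostAssumption c) {x : ℝ} (hx : 0 ≤ x) (hx1 : x ≤ 1) :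
    derivWithin c (Icc 0 1) 0 * x ≤ c x := by
  rcases hx.eq_or_lt with rfl | hx
  · simp [hc.map_zero]
  have h := hc.strictConvexOn.convexOn.derivWithin_le_slope (x := 0) (y := x)
    (by simp) ⟨hx.le, hx1⟩ hx (hc.differentiableOn 0 (by simp))
  rw [slope_def_field, hc.map_zero, sub_zero, sub_zero, le_div_iff₀ hx] at h
  exact h

/-- A convex function on `[0, 1]` that is differentiable at `1` increases at most at the rate of
its final derivative. -/
theorem sub_le (hc : CostAssumption c) {x y : ℝ} (hx : 0 ≤ x) (hxy : x ≤ y) (hy : y ≤ 1) :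
    c y - c x ≤ derivWithin c (Icc 0 1) 1 * (y - x) := by
  rcases hxy.eq_or_lt with rfl | hxy
  · simp
  have hd := hc.strictConvexOn.convexOn.slope_le_derivWithin (x := x) (y := 1)
    ⟨hx, hxy.le.trans hy⟩ (by simp) (hxy.trans_le hy) (hc.differentiableOn 1 (by simp))
  have hs := hc.strictConvexOn.convexOn.slope_mono (x := x) ⟨hx, hxy.le.trans hy⟩
    (a := y) ⟨⟨hx.trans hxy.le, hy⟩, hxy.ne'⟩ (b := 1)
    ⟨by simp, (hxy.trans_le hy).ne'⟩ hy
  have h := hs.trans hd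
  rw [slope_def_field, div_le_iff₀ (sub_pos.2 hxy)] at h
  exact h

theorem le_mul (hc : CostAssumption c) {x : ℝ} (hx : 0 ≤ x) (hx1 : x ≤ 1) :
    c x ≤ derivWithin c (Icc 0 1) 1 * x := by
  simpa [hc.map_zero] using hc.sub_le le_rfl hx hx1

theorem deriv_one_pos (hc : CostAssumption c) : 0 < derivWithin c (Icc 0 1) 1 := by
  have h1 := hc.marginal_mul_le zero_le_one le_rfl
  have h2 := hc.le_mul zero_le_one le_rfl
  have := hc.deriv_zero_pos
  linarith

theorem continuous_comp_coe (hc : CostAssumption c) : Continuous fun x : I => c x :=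
  hc.continuousOn.comp_continuous continuous_subtype_val fun x => x.2

theorem tendsto_div (hc : CostAssumption c) :
    Tendsto (fun x : ℝ => c x / x) (𝓝[Ioc 0 1] 0) (𝓝 (derivWithin c (Icc 0 1) 0)) := by
  have h := (hc.differentiableOn 0 (by simp)).hasDerivWithinAt
  rw [hasDerivWithinAt_iff_tendsto_slope] at h
  have h2 := h.mono_left (nhdsWithin_mono (0 : ℝ)
    (show Ioc (0 : ℝ) 1 ⊆ Icc 0 1 \ {0} from fun x hx => ⟨⟨hx.1.le, hx.2⟩, hx.1.ne'⟩))
  refine h2.congr fun x => ?_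
  rw [slope_def_field, hc.map_zero, sub_zero, sub_zero]

end CostAssumption

theorem TransactionAssumption.nonneg {g : ℕ+ → ℝ} (hg : TransactionAssumption g) (k : ℕ+) :
    0 ≤ g k :=
  hg.map_one ▸ hg.strictMono.monotone one_le

/-! ### Shares -/

@[simp]
theorem coe_share (t : I) (k : ℕ+) : ((share t k : I) : ℝ) = (t : ℝ) / (k : ℕ) := rfl

theorem share_mono {t t' : I} (h : t ≤ t') (k : ℕ+) : share t k ≤ share t' k :=
  Subtype.coe_le_coe.1 (div_le_div_of_nonneg_right (Subtype.coe_le_coe.2 h) (Nat.cast_nonneg _))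

theorem share_le (t : I) (k : ℕ+) : share t k ≤ t :=
  Subtype.coe_le_coe.1 (div_le_self t.2.1 (Nat.one_le_cast.2 k.pos))

@[simp]
theorem share_zero (k : ℕ+) : share 0 k = 0 := Subtype.ext (by simp)

theorem pnat_mul_share (t : I) (k : ℕ+) : ((k : ℕ) : ℝ) * (share t k : ℝ) = t := by
  have : ((k : ℕ) : ℝ) ≠ 0 := Nat.cast_ne_zero.2 k.pos.ne'
  rw [coe_share]; field_simp

theorem continuous_share (k : ℕ+) : Continuous fun t : I => share t k :=
  (continuous_subtype_val.div_const _).subtype_mk _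

/-! ### The shifted Poisson law -/

theorem shiftedPoisson_nonneg {l : ℝ} (hl : 0 ≤ l) (k : ℕ+) : 0 ≤ shiftedPoisson l k := by
  unfold shiftedPoisson; positivity

theorem continuous_shiftedPoisson (k : ℕ+) : Continuous fun l : ℝ => shiftedPoisson l k := by
  unfold shiftedPoisson; fun_prop

theorem hasSum_shiftedPoisson {l : ℝ} (hl : 0 ≤ l) : HasSum (shiftedPoisson l) 1 := by
  have h := ProbabilityTheory.hasSum_one_poissonMeasure ⟨l, hl⟩
  rw [← Equiv.pnatEquivNat.hasSum_iff] at h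
  convert! h using 1
  ext k
  simp [shiftedPoisson, PNat.natPred, mul_comm]
  rfl

theorem hasSum_mul_shiftedPoisson_zero (F : ℕ+ → ℝ) :
    HasSum (fun k => F k * shiftedPoisson 0 k) (F 1) := by
  have h := hasSum_single (f := fun k => F k * shiftedPoisson 0 k) 1 (fun k hk => by
    have : (k : ℕ) - 1 ≠ 0 := by
      have h1 : (k : ℕ) ≠ 1 := fun h => hk (PNat.coe_eq_one_iff.1 h)
      have := k.pos
      omega
    simp [shiftedPoisson, this])
  simpa [shiftedPoisson] using h

theorem tendsto_shiftedPoisson_atTop (k : ℕ+) :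
    Tendsto (fun l : ℝ => shiftedPoisson l k) atTop (𝓝 0) := by
  unfold shiftedPoisson
  simpa using (Real.tendsto_pow_mul_exp_neg_atTop_nhds_zero ((k : ℕ) - 1)).div_const
    ((((k : ℕ) - 1)! : ℕ) : ℝ)

/-- Comparison of expectations under the shifted Poisson law. -/
theorem exists_hasSum_shiftedPoisson_le {l : ℝ} (hl : 0 ≤ l) {F G : ℕ+ → ℝ} {A B e : ℝ}
    (hG : HasSum (fun k => G k * shiftedPoisson l k) e) (h0 : ∀ k, 0 ≤ F k)
    (hFG : ∀ k, F k ≤ A * G k + B) :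
    ∃ e', HasSum (fun k => F k * shiftedPoisson l k) e' ∧ e' ≤ A * e + B := by
  have hb : HasSum (fun k => A * (G k * shiftedPoisson l k) + B * shiftedPoisson l k)
      (A * e + B) := by
    simpa using (hG.mul_left A).add ((hasSum_shiftedPoisson hl).mul_left B)
  have hle : ∀ k, F k * shiftedPoisson l k ≤
      A * (G k * shiftedPoisson l k) + B * shiftedPoisson l k := fun k => by
    have := mul_le_mul_of_nonneg_right (hFG k) (shiftedPoisson_nonneg hl k)
    linarith
  have hs : Summable fun k => F k * shiftedPoisson l k :=
    Summable.of_nonneg_of_le (fun k => mul_nonneg (h0 k) (shiftedPoisson_nonneg hl k)) hle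
      hb.summable
  exact ⟨_, hs.hasSum, hasSum_le hle hs.hasSum hb⟩

theorem le_of_hasSum_shiftedPoisson {l : ℝ} (hl : 0 ≤ l) {F : ℕ+ → ℝ} {B e : ℝ}
    (hF : HasSum (fun k => F k * shiftedPoisson l k) e) (hB : ∀ k, B ≤ F k) : B ≤ e := by
  refine hasSum_le (fun k => mul_le_mul_of_nonneg_right (hB k) (shiftedPoisson_nonneg hl k)) ?_ hF
  simpa using (hasSum_shiftedPoisson hl).mul_left B

/-- The expectation of a function that dominates one tending to infinity exceeds every bound when
the parameter of the law is large. -/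
theorem exists_forall_le_hasSum_shiftedPoisson {g : ℕ+ → ℝ} (hg : TransactionAssumption g)
    (M : ℝ) : ∃ R : ℝ, 0 ≤ R ∧ ∀ l, R < l → ∀ F : ℕ+ → ℝ, (∀ k, g k ≤ F k) → ∀ e,
      HasSum (fun k => F k * shiftedPoisson l k) e → M ≤ e := by
  obtain ⟨N, hN⟩ := eventually_atTop.1 (hg.tendsto.eventually_ge_atTop (2 * |M|))
  have ht : Tendsto (fun l : ℝ => ∑ k ∈ Finset.Iio N, shiftedPoisson l k) atTop (𝓝 0) := by
    simpa using tendsto_finsetSum (Finset.Iio N) fun k _ => tendsto_shiftedPoisson_atTop k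
  obtain ⟨R, hR⟩ := eventually_atTop.1 (ht.eventually_le_const (show (0 : ℝ) < 1 / 2 by norm_num))
  refine ⟨max R 0, le_max_right _ _, fun l hl F hF e he => ?_⟩
  have hl0 : 0 ≤ l := (le_max_right R 0).trans hl.le
  -- The minorant is 2|M| on k ≥ N and 0 below N. For large l the mass below N is at most 1/2, so
  -- its expectation is at least |M|.
  have hlow : HasSum (fun k => 2 * |M| * shiftedPoisson l k -
      2 * |M| * (if k ∈ Finset.Iio N then shiftedPoisson l k else 0))
      (2 * |M| * 1 - 2 * |M| * ∑ k ∈ Finset.Iio N, shiftedPoisson l k) := by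
    refine ((hasSum_shiftedPoisson hl0).mul_left _).sub (HasSum.mul_left _ ?_)
    have : HasSum (fun k => if k ∈ Finset.Iio N then shiftedPoisson l k else 0)
        (∑ k ∈ Finset.Iio N, if k ∈ Finset.Iio N then shiftedPoisson l k else 0) :=
      hasSum_sum_of_ne_finset_zero fun k hk => if_neg hk
    rwa [Finset.sum_congr rfl fun k hk => if_pos hk] at this
  have hle := hasSum_le (fun k => ?_) hlow he
  · have h1 := hR l ((le_max_left R 0).trans hl.le)
    have := le_abs_self M
    nlinarith [abs_nonneg M]
  · have hp := shiftedPoisson_nonneg hl0 k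
    split_ifs with hk
    · have := mul_nonneg ((hg.nonneg k).trans (hF k)) hp
      linarith
    · have hk' : N ≤ k := by simpa using hk
      have := mul_le_mul_of_nonneg_right ((hN k hk').trans (hF k)) hp
      linarith

/-! ### Cost values and attainment of the minimum -/

section CostValues

variable {c : ℝ → ℝ} {g : ℕ+ → ℝ} {δ : ℝ} {p q : I → ℝ} {s r : ℝ}

theorem zero_mem_costValues (hg : TransactionAssumption g) (hr : 0 ≤ r) :
    c s + δ * p 0 ∈ costValues c g δ p s r :=
  ⟨0, hr, 0, le_rfl, δ * p 0, by
    simpa [hg.map_one] using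
      hasSum_mul_shiftedPoisson_zero fun k : ℕ+ => g k + δ * (k : ℕ) * p (share 0 k), by simp⟩

/-- Only prices at t / k ≤ t ≤ r enter. This is why a pass of the grid loop may be evaluated with
the final output in place of the current state. -/
theorem costValues_congr (h : ∀ t : I, (t : ℝ) ≤ r → p t = q t) :
    costValues c g δ p s r = costValues c g δ q s r := by
  have key : ∀ t : I, (t : ℝ) ≤ r → ∀ k, p (share t k) = q (share t k) := fun t ht k =>
    h _ ((Subtype.coe_le_coe.2 (share_le t k)).trans ht)
  ext x
  constructor
  · rintro ⟨t, ht, l, hl, e, he, rfl⟩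
    exact ⟨t, ht, l, hl, e, by simpa only [key t ht] using he, rfl⟩
  · rintro ⟨t, ht, l, hl, e, he, rfl⟩
    exact ⟨t, ht, l, hl, e, by simpa only [key t ht] using he, rfl⟩

theorem payoff_nonneg (hg : TransactionAssumption g) (hδ : 0 ≤ δ) (hp : ∀ t, 0 ≤ p t) (t : I)
    (k : ℕ+) : 0 ≤ g k + δ * (k : ℕ) * p (share t k) :=
  add_nonneg (hg.nonneg k) (mul_nonneg (mul_nonneg hδ (Nat.cast_nonneg _)) (hp _))

theorem bddBelow_costValues (hc : CostAssumption c) (hg : TransactionAssumption g) (hδ : 0 ≤ δ)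
    (hp : ∀ t, 0 ≤ p t) (hrs : r ≤ s) (hs : s ≤ 1) : BddBelow (costValues c g δ p s r) := by
  refine ⟨0, ?_⟩
  rintro _ ⟨t, ht, l, hl, e, he, rfl⟩
  have h1 := hc.nonneg (x := s - t) (by linarith) (by have := t.2.1; linarith)
  have h2 := le_of_hasSum_shiftedPoisson hl he (payoff_nonneg hg hδ hp t)
  exact add_nonneg h1 h2

/-- The minimal cost is attained: the expected cost is a lower semicontinuous function of the
decision variables, and tends to infinity with the parameter of the Poisson law. -/
theorem isLeast_sInf_costValues (hc : CostAssumption c) (hg : TransactionAssumption g)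
    (hδ : 0 ≤ δ) (hpc : Continuous p) (hp : ∀ t, 0 ≤ p t) (hr : 0 ≤ r) (hrs : r ≤ s)
    (hs : s ≤ 1) : IsLeast (costValues c g δ p s r) (sInf (costValues c g δ p s r)) := by
  suffices h : ∃ x, IsLeast (costValues c g δ p s r) x by
    obtain ⟨x, hx⟩ := h
    rwa [hx.csInf_eq]
  obtain ⟨R, hR0, hR⟩ := exists_forall_le_hasSum_shiftedPoisson hg (c s + δ * p 0)
  set F : I × ℝ → ENNReal := fun z =>
    ENNReal.ofReal (IccExtend zero_le_one ((Icc 0 1).domRestrict c) (s - z.1)) +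
      ∑' k : ℕ+, ENNReal.ofReal
        ((g k + δ * (k : ℕ) * p (share z.1 k)) * shiftedPoisson z.2 k) with hF
  have hlsc : LowerSemicontinuous F := by
    refine LowerSemicontinuous.add (Continuous.lowerSemicontinuous ?_)
      (lowerSemicontinuous_tsum fun k => Continuous.lowerSemicontinuous ?_)
    · refine ENNReal.continuous_ofReal.comp ((hc.continuousOn.domRestrict.Icc_extend').comp ?_)
      fun_prop
    · refine ENNReal.continuous_ofReal.comp (Continuous.mul ?_ ?_)
      · exact continuous_const.add (continuous_const.mul
          (hpc.comp ((continuous_share k).comp continuous_fst)))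
      · exact (continuous_shiftedPoisson k).comp continuous_snd
  have hFval : ∀ t : I, (t : ℝ) ≤ r → ∀ l, 0 ≤ l → ∀ e,
      HasSum (fun k : ℕ+ => (g k + δ * (k : ℕ) * p (share t k)) * shiftedPoisson l k) e →
      F (t, l) = ENNReal.ofReal (c (s - t) + e) := by
    intro t ht l hl e he
    have hmem : s - (t : ℝ) ∈ Icc (0 : ℝ) 1 := ⟨by linarith, by have := t.2.1; linarith⟩
    have hnn : ∀ k : ℕ+, 0 ≤ (g k + δ * (k : ℕ) * p (share t k)) * shiftedPoisson l k :=
      fun k => mul_nonneg (payoff_nonneg hg hδ hp t k) (shiftedPoisson_nonneg hl k)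
    rw [ENNReal.ofReal_add (hc.nonneg hmem.1 hmem.2) (he.nonneg hnn), ← he.tsum_eq,
      ENNReal.ofReal_tsum_of_nonneg hnn he.summable]
    simp only [hF, IccExtend_of_mem _ _ hmem]
    rfl
  have hK : IsCompact ({t : I | (t : ℝ) ≤ r} ×ˢ Icc (0 : ℝ) R) :=
    (isClosed_le continuous_subtype_val continuous_const).isCompact.prod isCompact_Icc
  have h0K : ((0 : I), (0 : ℝ)) ∈ {t : I | (t : ℝ) ≤ r} ×ˢ Icc (0 : ℝ) R :=
    ⟨hr, le_rfl, hR0⟩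
  obtain ⟨⟨t, l⟩, ⟨ht, hl⟩, hmin⟩ :=
    LowerSemicontinuousOn.exists_isMinOn ⟨_, h0K⟩ hK (hlsc.lowerSemicontinuousOn _)
  simp only [mem_ofPred_eq] at ht
  have h00 : F (0, 0) = ENNReal.ofReal (c s + δ * p 0) := by
    have := hFval 0 hr 0 le_rfl (δ * p 0) (by
      simpa [hg.map_one] using
        hasSum_mul_shiftedPoisson_zero fun k : ℕ+ => g k + δ * (k : ℕ) * p (share 0 k))
    simpa using this
  have hle0 : F (t, l) ≤ F (0, 0) := hmin h0K
  -- The minimum over the compact set is at most the finite cost of t = 0, l = 0, so the minimizer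
  -- has a genuine sum.
  have hfin : ∑' k : ℕ+, ENNReal.ofReal
      ((g k + δ * (k : ℕ) * p (share t k)) * shiftedPoisson l k) ≠ ⊤ := by
    refine ne_top_of_le_ne_top (?_ : F (0, 0) ≠ ⊤) (le_add_self.trans hle0)
    rw [h00]; exact ENNReal.ofReal_ne_top
  have hsum : Summable fun k : ℕ+ =>
      (g k + δ * (k : ℕ) * p (share t k)) * shiftedPoisson l k := by
    refine (ENNReal.summable_toReal hfin).congr fun k => ?_
    exact ENNReal.toReal_ofReal
      (mul_nonneg (payoff_nonneg hg hδ hp t k) (shiftedPoisson_nonneg hl.1 k))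
  have hval := hFval t ht l hl.1 _ hsum.hasSum
  refine ⟨_, ⟨t, ht, l, hl.1, _, hsum.hasSum, rfl⟩, ?_⟩
  rintro _ ⟨t', ht', l', hl', e', he', rfl⟩
  have hc' : 0 ≤ c (s - t') := hc.nonneg (by linarith) (by have := t'.2.1; linarith)
  have he0 : 0 ≤ e' := le_of_hasSum_shiftedPoisson hl' he' (payoff_nonneg hg hδ hp t')
  rcases le_or_gt l' R with h | h
  · have := hmin (show (t', l') ∈ {t : I | (t : ℝ) ≤ r} ×ˢ Icc (0 : ℝ) R from ⟨ht', hl', h⟩)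
    simp only [mem_ofPred_eq] at this
    rw [hval, hFval t' ht' l' hl' e' he', ENNReal.ofReal_le_ofReal_iff (by linarith)] at this
    exact this
  -- Beyond R the expectation alone is at least the cost of t = 0, l = 0.
  · have h1 := hR l' h _ (fun k => le_add_of_nonneg_right
      (mul_nonneg (mul_nonneg hδ (Nat.cast_nonneg _)) (hp _))) e' he'
    have h2 : 0 ≤ c s + δ * p 0 :=
      add_nonneg (hc.nonneg (hr.trans hrs) hs) (mul_nonneg hδ (hp 0))
    rw [hval, h00, ENNReal.ofReal_le_ofReal_iff h2] at hle0
    linarith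

end CostValues

/-! ### The order interval -/

/-- Membership of a price function in the order interval, for functions that are not bundled. -/
structure Admissible (c : ℝ → ℝ) (p : I → ℝ) : Prop where
  continuous : Continuous p
  lower : ∀ s : I, derivWithin c (Icc 0 1) 0 * s ≤ p s
  upper : ∀ s : I, p s ≤ c s

theorem admissible_of_mem_orderInterval {c : ℝ → ℝ} {p : C(I, ℝ)} (hp : p ∈ orderInterval c) :
    Admissible c p :=
  ⟨p.continuous, fun s => (hp s).1, fun s => (hp s).2⟩

section

variable {c : ℝ → ℝ} {g : ℕ+ → ℝ} {δ : ℝ} {p q : I → ℝ}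

theorem admissible_lower (hc : CostAssumption c) :
    Admissible c fun x : I => derivWithin c (Icc 0 1) 0 * x :=
  ⟨by fun_prop, fun _ => le_rfl, fun x => hc.marginal_mul_le x.2.1 x.2.2⟩

theorem admissible_upper (hc : CostAssumption c) : Admissible c fun x : I => c x :=
  ⟨hc.continuous_comp_coe, fun x => hc.marginal_mul_le x.2.1 x.2.2, fun _ => le_rfl⟩

namespace Admissible

theorem nonneg (hc : CostAssumption c) (hp : Admissible c p) (s : I) : 0 ≤ p s :=
  (mul_nonneg hc.deriv_zero_pos.le s.2.1).trans (hp.lower s)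

theorem map_zero (hc : CostAssumption c) (hp : Admissible c p) : p 0 = 0 :=
  le_antisymm (by simpa [hc.map_zero] using hp.upper 0) (hp.nonneg hc 0)

theorem le_cost_one (hc : CostAssumption c) (hp : Admissible c p) (s : I) : p s ≤ c 1 :=
  (hp.upper s).trans (hc.mono s.2.1 s.2.2 le_rfl)

theorem convex_comb (hp : Admissible c p) (hq : Admissible c q) {τ : ℝ} (h0 : 0 ≤ τ)
    (h1 : τ ≤ 1) : Admissible c fun x => τ * p x + (1 - τ) * q x := by
  refine ⟨(hp.continuous.const_mul τ).add (hq.continuous.const_mul _), fun s => ?_, fun s => ?_⟩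
  · have h2 := mul_le_mul_of_nonneg_left (hp.lower s) h0
    have h3 := mul_le_mul_of_nonneg_left (hq.lower s) (sub_nonneg.2 h1)
    linarith
  · have h2 := mul_le_mul_of_nonneg_left (hp.upper s) h0
    have h3 := mul_le_mul_of_nonneg_left (hq.upper s) (sub_nonneg.2 h1)
    linarith

/-- The average price `p x / x` extends continuously to `x = 0`. -/
theorem exists_average (hc : CostAssumption c) (hp : Admissible c p) :
    ∃ avg : I → ℝ, Continuous avg ∧ (∀ x, derivWithin c (Icc 0 1) 0 ≤ avg x) ∧
      (∀ x, avg x ≤ derivWithin c (Icc 0 1) 1) ∧ ∀ x, p x = x * avg x := by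
  classical
  have hpos : ∀ x : I, x ≠ 0 → (0 : ℝ) < x := fun x hx => unitInterval.pos_iff_ne_zero.2 hx
  refine ⟨fun x => if x = 0 then derivWithin c (Icc 0 1) 0 else p x / x, ?_, ?_, ?_, ?_⟩
  · rw [continuous_iff_continuousAt]
    intro x
    by_cases hx : x = 0
    · subst hx
      rw [continuousAt_iff_punctured_nhds]
      simp only [if_true]
      have hcoe : Tendsto (fun x : I => (x : ℝ)) (𝓝[≠] 0) (𝓝[Ioc 0 1] 0) := by
        refine tendsto_nhdsWithin_iff.2 ⟨?_, ?_⟩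
        · exact (continuous_subtype_val.tendsto (0 : I)).mono_left nhdsWithin_le_nhds
        · filter_upwards [self_mem_nhdsWithin] with x hx using ⟨hpos x hx, x.2.2⟩
      -- Squeeze p x / x between c'(0) and c x / x.
      refine tendsto_of_tendsto_of_tendsto_of_le_of_le' tendsto_const_nhds
        (hc.tendsto_div.comp hcoe) ?_ ?_
      · filter_upwards [self_mem_nhdsWithin] with x hx
        rw [if_neg (show x ≠ 0 from hx), le_div_iff₀ (hpos x hx)]
        exact hp.lower x
      · filter_upwards [self_mem_nhdsWithin] with x hx
        rw [if_neg (show x ≠ 0 from hx)]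
        exact div_le_div_of_nonneg_right (hp.upper x) x.2.1
    · have h : ContinuousAt (fun x : I => p x / x) x :=
        hp.continuous.continuousAt.div continuous_subtype_val.continuousAt (hpos x hx).ne'
      refine h.congr ?_
      filter_upwards [isOpen_ne.mem_nhds hx] with y hy
      rw [if_neg hy]
  · intro x
    dsimp only
    split_ifs with hx
    · exact le_rfl
    · rw [le_div_iff₀ (hpos x hx)]
      exact hp.lower x
  · intro x
    dsimp only
    split_ifs with hx
    · have h1 := hc.marginal_mul_le zero_le_one le_rfl
      have h2 := hc.le_mul zero_le_one le_rfl
      linarith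
    · rw [div_le_iff₀ (hpos x hx)]
      exact (hp.upper x).trans (hc.le_mul x.2.1 x.2.2)
  · intro x
    dsimp only
    split_ifs with hx
    · subst hx
      simp [hp.map_zero hc]
    · rw [mul_div_cancel₀ _ (hpos x hx).ne']

theorem pnat_mul_le (hc : CostAssumption c) (hp : Admissible c p) (t : I) (k : ℕ+) :
    ((k : ℕ) : ℝ) * p (share t k) ≤ derivWithin c (Icc 0 1) 1 := by
  have h1 := (hp.upper (share t k)).trans (hc.le_mul (share t k).2.1 (share t k).2.2)
  calc ((k : ℕ) : ℝ) * p (share t k)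
      ≤ (k : ℕ) * (derivWithin c (Icc 0 1) 1 * share t k) :=
        mul_le_mul_of_nonneg_left h1 (Nat.cast_nonneg _)
    _ = derivWithin c (Icc 0 1) 1 * t := by rw [← pnat_mul_share t k]; ring
    _ ≤ derivWithin c (Icc 0 1) 1 * 1 := mul_le_mul_of_nonneg_left t.2.2 hc.deriv_one_pos.le
    _ = _ := mul_one _

/-- The functions `t ↦ k p (t / k)` are equicontinuous. -/
theorem exists_pnat_mul_le_add (hc : CostAssumption c) (hp : Admissible c p) {ε : ℝ}
    (hε : 0 < ε) : ∃ d > 0, ∀ t t' : I, dist t t' < d → ∀ k : ℕ+,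
      ((k : ℕ) : ℝ) * p (share t k) ≤ (k : ℕ) * p (share t' k) + ε := by
  obtain ⟨avg, havgc, havg0, havg1, havg⟩ := hp.exists_average hc
  have hL := hc.deriv_one_pos
  have hcont := CompactSpace.uniformContinuous_of_continuous havgc
  obtain ⟨d, hd, hdavg⟩ := Metric.uniformContinuous_iff.1 hcont (ε / 2) (half_pos hε)
  refine ⟨min d (ε / 2 / derivWithin c (Icc 0 1) 1), lt_min hd (by positivity),
    fun t t' htt k => ?_⟩
  -- Rewriting k p(t/k) as t · avg(t/k) makes the estimate uniform in k: t ↦ t/k is 1-Lipschitz and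
  -- avg is bounded. The two entries in the choice of d control the change of avg and the change of
  -- the factor t, by ε/2 each.
  have e : ∀ t : I, ((k : ℕ) : ℝ) * p (share t k) = t * avg (share t k) := fun t => by
    rw [havg, ← mul_assoc, pnat_mul_share]
  have hdist : dist (share t k) (share t' k) ≤ dist t t' := by
    rw [Subtype.dist_eq, Subtype.dist_eq, coe_share, coe_share, Real.dist_eq, Real.dist_eq,
      ← sub_div, abs_div, abs_of_nonneg (Nat.cast_nonneg (α := ℝ) (k : ℕ))]
    exact div_le_self (abs_nonneg _) (Nat.one_le_cast.2 k.pos)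
  have h1 := hdavg (hdist.trans_lt (htt.trans_le (min_le_left _ _)))
  have h2 := htt.trans_le (min_le_right _ _)
  rw [lt_div_iff₀ hL] at h2
  rw [Subtype.dist_eq, Real.dist_eq] at h2
  rw [Real.dist_eq] at h1
  rw [e t, e t']
  have h3 : ((t : ℝ) - t') * avg (share t k) ≤ ε / 2 := by
    have h4 : ((t : ℝ) - t') * avg (share t k) ≤ |(t : ℝ) - t'| * avg (share t k) :=
      mul_le_mul_of_nonneg_right (le_abs_self _) (hc.deriv_zero_pos.le.trans (havg0 _))
    have h5 := mul_le_mul_of_nonneg_left (havg1 (share t k)) (abs_nonneg ((t : ℝ) - t'))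
    linarith
  have h6 : (t' : ℝ) * (avg (share t k) - avg (share t' k)) ≤ ε / 2 := by
    have h7 := mul_le_mul_of_nonneg_left ((le_abs_self _).trans h1.le) t'.2.1
    have h8 : (t' : ℝ) * (ε / 2) ≤ 1 * (ε / 2) :=
      mul_le_mul_of_nonneg_right t'.2.2 (half_pos hε).le
    linarith
  linarith

end Admissible

/-! ### The operator on the order interval -/

/-- Since c and g are nonnegative and A ≥ 1, scaling prices by A scales each cost by at most A. This
carries relative errors through the operator. -/
theorem exists_mem_costValues_le_mul (hc : CostAssumption c) (hg : TransactionAssumption g)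
    (hδ : 0 ≤ δ) {A s r y : ℝ} (hA : 1 ≤ A) (hp : ∀ x, 0 ≤ p x) (hpq : ∀ x, p x ≤ A * q x)
    (hrs : r ≤ s) (hs : s ≤ 1) (hy : y ∈ costValues c g δ q s r) :
    ∃ x ∈ costValues c g δ p s r, x ≤ A * y := by
  obtain ⟨t, ht, l, hl, e, he, rfl⟩ := hy
  obtain ⟨e', he', hle⟩ := exists_hasSum_shiftedPoisson_le hl he (A := A) (B := 0)
    (payoff_nonneg hg hδ hp t) (fun k => by
      have h1 := mul_le_mul_of_nonneg_left (hpq (share t k))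
        (mul_nonneg hδ (Nat.cast_nonneg (α := ℝ) (k : ℕ)))
      have h2 := mul_le_mul_of_nonneg_right hA (hg.nonneg k)
      linarith)
  refine ⟨_, ⟨t, ht, l, hl, e', he', rfl⟩, ?_⟩
  have h3 := mul_le_mul_of_nonneg_right hA
    (hc.nonneg (x := s - t) (by linarith) (by have := t.2.1; linarith))
  linarith

theorem le_stochT (hg : TransactionAssumption g) {s : I} {b : ℝ}
    (h : ∀ x ∈ costValues c g δ p s s, b ≤ x) : b ≤ stochT c g δ p s :=
  le_csInf ⟨_, zero_mem_costValues hg s.2.1⟩ h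

theorem stochT_le (hc : CostAssumption c) (hg : TransactionAssumption g) (hδ : 0 ≤ δ)
    (hp : ∀ x, 0 ≤ p x) {s : I} {x : ℝ} (hx : x ∈ costValues c g δ p s s) :
    stochT c g δ p s ≤ x :=
  csInf_le (bddBelow_costValues hc hg hδ hp le_rfl s.2.2) hx

theorem isLeast_stochT (hc : CostAssumption c) (hg : TransactionAssumption g) (hδ : 0 ≤ δ)
    (hp : Admissible c p) (s : I) : IsLeast (costValues c g δ p s s) (stochT c g δ p s) :=
  isLeast_sInf_costValues hc hg hδ hp.continuous (hp.nonneg hc) s.2.1 le_rfl s.2.2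

theorem stochT_le_mul (hc : CostAssumption c) (hg : TransactionAssumption g)
    (hδ : 0 ≤ δ) {A : ℝ} (hA : 1 ≤ A) (hp : ∀ x, 0 ≤ p x) (hq : Admissible c q)
    (hpq : ∀ x, p x ≤ A * q x) (s : I) : stochT c g δ p s ≤ A * stochT c g δ q s := by
  obtain ⟨x, hx, hle⟩ := exists_mem_costValues_le_mul hc hg hδ hA hp hpq le_rfl s.2.2
    (isLeast_stochT hc hg hδ hq s).1
  exact (stochT_le hc hg hδ hp hx).trans hle

theorem stochT_mono (hc : CostAssumption c) (hg : TransactionAssumption g)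
    (hδ : 0 ≤ δ) (hp : Admissible c p) (hq : Admissible c q) (hpq : ∀ x, p x ≤ q x) (s : I) :
    stochT c g δ p s ≤ stochT c g δ q s := by
  simpa using stochT_le_mul hc hg hδ le_rfl (hp.nonneg hc) hq (by simpa using hpq) s

/-- Under a linear price the number of partners cancels, k · (t/k) = t, and g ≥ 0 is dropped. The
bound on p is required only up to r so that it can serve in the induction along the grid. -/
theorem add_le_of_mem_costValues (hg : TransactionAssumption g) (hδ : 1 ≤ δ) {s r x : ℝ}
    (hp : ∀ t : I, (t : ℝ) ≤ r → derivWithin c (Icc 0 1) 0 * t ≤ p t)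
    (hx : x ∈ costValues c g δ p s r) : ∃ t : I, (t : ℝ) ≤ r ∧
      c (s - t) + δ * (derivWithin c (Icc 0 1) 0 * t) ≤ x := by
  obtain ⟨t, ht, l, hl, e, he, rfl⟩ := hx
  refine ⟨t, ht, add_le_add_right (le_of_hasSum_shiftedPoisson hl he fun k => ?_) _⟩
  have h := mul_le_mul_of_nonneg_left
    (hp (share t k) ((Subtype.coe_le_coe.2 (share_le t k)).trans ht))
    (Nat.cast_nonneg (α := ℝ) (k : ℕ))
  have h2 := mul_le_mul_of_nonneg_left h (zero_le_one.trans hδ)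
  have h3 := hg.nonneg k
  rw [← pnat_mul_share t k]
  linarith

theorem lower_le_of_mem_costValues (hc : CostAssumption c) (hg : TransactionAssumption g)
    (hδ : 1 ≤ δ) {s r x : ℝ} (hrs : r ≤ s) (hs : s ≤ 1)
    (hp : ∀ t : I, (t : ℝ) ≤ r → derivWithin c (Icc 0 1) 0 * t ≤ p t)
    (hx : x ∈ costValues c g δ p s r) : derivWithin c (Icc 0 1) 0 * s ≤ x := by
  obtain ⟨t, ht, hle⟩ := add_le_of_mem_costValues hg hδ hp hx
  have h1 := hc.marginal_mul_le (x := s - t) (by linarith) (by have := t.2.1; linarith)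
  have h2 := mul_le_mul_of_nonneg_right hδ (mul_nonneg hc.deriv_zero_pos.le t.2.1)
  linarith

/-- Keep the optimal decision for s and let the cost c absorb the extra length s' - s, at rate at
most c'(1). -/
theorem stochT_le_stochT_add (hc : CostAssumption c) (hg : TransactionAssumption g)
    (hδ : 0 ≤ δ) (hp : Admissible c p) {s s' : I} (h : s ≤ s') :
    stochT c g δ p s' ≤
      stochT c g δ p s + derivWithin c (Icc 0 1) 1 * ((s' : ℝ) - s) := by
  obtain ⟨t, ht, l, hl, e, he, heq⟩ := (isLeast_stochT hc hg hδ hp s).1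
  have hss : (s : ℝ) ≤ s' := h
  have h1 := stochT_le hc hg hδ (hp.nonneg hc) (s := s') ⟨t, ht.trans hss, l, hl, e, he, rfl⟩
  have h2 := hc.sub_le (x := s - t) (y := s' - t) (by linarith) (by linarith)
    (by have := t.2.1; have := s'.2.2; linarith)
  have h3 : (s' : ℝ) - t - (s - t) = s' - s := by ring
  rw [h3] at h2
  rw [heq]
  linarith

/-- An optimal t for s' that is at most s remains feasible for s at no greater cost. Otherwise t is
replaced by s: the term c(s - s) vanishes and the expectation grows by at most δ ε. -/
theorem stochT_le_add_of_equicontinuous (hc : CostAssumption c) (hg : TransactionAssumption g)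
    (hδ : 0 ≤ δ) (hp : Admissible c p) {s s' : I} (h : s ≤ s') {ε : ℝ} (hε : 0 ≤ ε)
    (heq : ∀ t : I, s ≤ t → t ≤ s' → ∀ k : ℕ+,
      ((k : ℕ) : ℝ) * p (share s k) ≤ (k : ℕ) * p (share t k) + ε) :
    stochT c g δ p s ≤ stochT c g δ p s' + δ * ε := by
  obtain ⟨t, ht, l, hl, e, he, hval⟩ := (isLeast_stochT hc hg hδ hp s').1
  have hss : (s : ℝ) ≤ s' := h
  rw [hval]
  rcases le_or_gt t s with hts | hts
  · have hts' : (t : ℝ) ≤ s := hts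
    have h1 := stochT_le hc hg hδ (hp.nonneg hc) (s := s) ⟨t, hts', l, hl, e, he, rfl⟩
    have h2 := hc.mono (x := s - t) (y := s' - t) (by linarith) (by linarith)
      (by have := t.2.1; have := s'.2.2; linarith)
    have := mul_nonneg hδ hε
    linarith
  · obtain ⟨e', he', hle⟩ := exists_hasSum_shiftedPoisson_le hl he (A := 1) (B := δ * ε)
      (payoff_nonneg hg hδ (hp.nonneg hc) s) (fun k => by
        have := mul_le_mul_of_nonneg_left (heq t hts.le ht k) hδ
        linarith)
    have h1 := stochT_le hc hg hδ (hp.nonneg hc) (s := s) ⟨s, le_rfl, l, hl, e', he', rfl⟩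
    rw [sub_self, hc.map_zero] at h1
    have h2 := hc.nonneg (x := s' - t) (sub_nonneg.2 ht)
      (by have := t.2.1; have := s'.2.2; linarith)
    linarith

theorem monotone_stochT (hc : CostAssumption c) (hg : TransactionAssumption g)
    (hδ : 0 ≤ δ) (hp : Admissible c p) (hm : Monotone p) : Monotone (stochT c g δ p) :=
  fun s s' h => by
    simpa using stochT_le_add_of_equicontinuous hc hg hδ hp h le_rfl fun t hst _ k => by
      simpa using mul_le_mul_of_nonneg_left (hm (share_mono hst k))
        (Nat.cast_nonneg (α := ℝ) (k : ℕ))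

theorem continuous_stochT (hc : CostAssumption c) (hg : TransactionAssumption g)
    (hδ : 0 < δ) (hp : Admissible c p) : Continuous (stochT c g δ p) := by
  have hL := hc.deriv_one_pos
  suffices h : ∀ ε > 0, ∃ d > 0, ∀ s s' : I, s ≤ s' → dist s s' < d →
      |stochT c g δ p s - stochT c g δ p s'| < ε by
    refine Metric.continuous_iff.2 fun s ε hε => ?_
    obtain ⟨d, hd, H⟩ := h ε hε
    refine ⟨d, hd, fun s' hs' => ?_⟩
    rw [Real.dist_eq]
    rcases le_total s' s with hss | hss
    · exact H s' s hss hs'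
    · rw [abs_sub_comm]
      exact H s s' hss (by rwa [dist_comm])
  intro ε hε
  obtain ⟨d, hd, hdp⟩ := hp.exists_pnat_mul_le_add hc (ε := ε / (2 * δ)) (by positivity)
  refine ⟨min d (ε / derivWithin c (Icc 0 1) 1), lt_min hd (by positivity),
    fun s s' hss hdist => ?_⟩
  have hss' : (s : ℝ) ≤ s' := hss
  have hde : dist s s' = (s' : ℝ) - s := by
    rw [Subtype.dist_eq, Real.dist_eq, abs_sub_comm, abs_of_nonneg (sub_nonneg.2 hss')]
  have h1 := stochT_le_stochT_add hc hg hδ.le hp hss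
  have h2 := stochT_le_add_of_equicontinuous hc hg hδ.le hp hss
    (ε := ε / (2 * δ)) (by positivity) fun t hst hts k => by
      refine hdp s t (lt_of_le_of_lt ?_ (hdist.trans_le (min_le_left _ _))) k
      have hst' : (s : ℝ) ≤ t := hst
      have hts' : (t : ℝ) ≤ s' := hts
      rw [hde, Subtype.dist_eq, Real.dist_eq, abs_sub_comm, abs_of_nonneg (sub_nonneg.2 hst')]
      linarith
  have h3 : δ * (ε / (2 * δ)) = ε / 2 := by field_simp
  have h4 := hdist.trans_le (min_le_right _ _)
  rw [hde, lt_div_iff₀ hL] at h4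
  rw [abs_lt]
  constructor <;> linarith

theorem Admissible.stochT (hc : CostAssumption c) (hg : TransactionAssumption g)
    (hδ : 1 < δ) (hp : Admissible c p) : Admissible c (stochT c g δ p) := by
  have hδ0 : 0 < δ := zero_lt_one.trans hδ
  refine ⟨continuous_stochT hc hg hδ0 hp, fun s => ?_, fun s => ?_⟩
  · exact le_stochT hg fun x hx =>
      lower_le_of_mem_costValues hc hg hδ.le le_rfl s.2.2 (fun t _ => hp.lower t) hx
  · simpa [hp.map_zero hc] using stochT_le hc hg hδ0.le (hp.nonneg hc)
      (zero_mem_costValues (c := c) (δ := δ) (p := p) (s := s) hg s.2.1)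

theorem Admissible.stochT_iterate (hc : CostAssumption c) (hg : TransactionAssumption g)
    (hδ : 1 < δ) (hp : Admissible c p) (n : ℕ) : Admissible c ((_root_.stochT c g δ)^[n] p) := by
  induction n with
  | zero => exact hp
  | succ n ih =>
    rw [Function.iterate_succ_apply']
    exact ih.stochT hc hg hδ

theorem stochT_iterate_mono (hc : CostAssumption c) (hg : TransactionAssumption g)
    (hδ : 1 < δ) (hp : Admissible c p) (hq : Admissible c q) (hpq : ∀ x, p x ≤ q x) (n : ℕ) :
    ∀ s, (stochT c g δ)^[n] p s ≤ (stochT c g δ)^[n] q s := by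
  induction n with
  | zero => exact hpq
  | succ n ih =>
    intro s
    rw [Function.iterate_succ_apply', Function.iterate_succ_apply']
    exact stochT_mono hc hg (zero_le_one.trans hδ.le) (hp.stochT_iterate hc hg hδ n)
      (hq.stochT_iterate hc hg hδ n) ih s

/-- The operator is concave on the order interval. -/
theorem stochT_concave (hc : CostAssumption c) (hg : TransactionAssumption g)
    (hδ : 0 ≤ δ) (hp : Admissible c p) (hq : Admissible c q) {τ : ℝ} (h0 : 0 ≤ τ)
    (h1 : τ ≤ 1) (s : I) : τ * stochT c g δ p s + (1 - τ) * stochT c g δ q s ≤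
      stochT c g δ (fun x => τ * p x + (1 - τ) * q x) s := by
  refine le_stochT hg ?_
  rintro _ ⟨t, ht, l, hl, e, he, rfl⟩
  have hr := hp.convex_comb hq h0 h1
  -- As k p'(t/k) is bounded by c'(1), finiteness of the expectation depends on g and l only, so it
  -- passes from the mixture to p and q separately.
  have key : ∀ p' : I → ℝ, Admissible c p' → ∃ e',
      HasSum (fun k : ℕ+ => (g k + δ * (k : ℕ) * p' (share t k)) * shiftedPoisson l k) e' :=
    fun p' hp' => by
      obtain ⟨e', he', -⟩ := exists_hasSum_shiftedPoisson_le hl he (A := 1)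
        (B := δ * derivWithin c (Icc 0 1) 1)
        (payoff_nonneg hg hδ (hp'.nonneg hc) t) (fun k => by
          have h2 := mul_le_mul_of_nonneg_left (hp'.pnat_mul_le hc t k) hδ
          have h3 := mul_nonneg (mul_nonneg hδ (Nat.cast_nonneg (α := ℝ) (k : ℕ)))
            (hr.nonneg hc (share t k))
          linarith)
      exact ⟨e', he'⟩
  obtain ⟨e₁, he₁⟩ := key p hp
  obtain ⟨e₂, he₂⟩ := key q hq
  have hsum : e = τ * e₁ + (1 - τ) * e₂ := by
    refine he.unique ?_
    convert! (he₁.mul_left τ).add (he₂.mul_left (1 - τ)) using 1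
    ext k
    ring
  have h2 := stochT_le hc hg hδ (hp.nonneg hc) (s := s) ⟨t, ht, l, hl, e₁, he₁, rfl⟩
  have h3 := stochT_le hc hg hδ (hq.nonneg hc) (s := s) ⟨t, ht, l, hl, e₂, he₂, rfl⟩
  have h4 := mul_le_mul_of_nonneg_left h2 h0
  have h5 := mul_le_mul_of_nonneg_left h3 (sub_nonneg.2 h1)
  rw [hsum]
  linarith

/-- The operator lifts the lower end of the order interval by a fixed fraction of its width. -/
theorem exists_lower_add_le_stochT (hc : CostAssumption c) (hg : TransactionAssumption g)
    (hδ : 1 < δ) : ∃ ε > 0, ε ≤ 1 ∧ ∀ s : I,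
      derivWithin c (Icc 0 1) 0 * s + ε * (c s - derivWithin c (Icc 0 1) 0 * s) ≤
        stochT c g δ (fun x : I => derivWithin c (Icc 0 1) 0 * x) s := by
  set a := derivWithin c (Icc 0 1) 0 with ha
  set b := derivWithin c (Icc 0 1) 1 with hb
  have ha0 : 0 < a := hc.deriv_zero_pos
  have hb0 : 0 < b := hc.deriv_one_pos
  have hδ1 : 0 < δ - 1 := sub_pos.2 hδ
  -- The cost exceeds a s by at least (c(s - t) - a(s - t)) + (δ - 1) a t, while c s - a s ≤ (c(s -
  -- t) - a(s - t)) + b t. Comparing terms requires ε ≤ 1 and ε b ≤ (δ - 1) a.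
  have hε0 : 0 < min 1 ((δ - 1) * a / b) := lt_min one_pos (by positivity)
  refine ⟨min 1 ((δ - 1) * a / b), hε0, min_le_left _ _, fun s => le_stochT hg fun x hx => ?_⟩
  obtain ⟨t, ht, hle⟩ := add_le_of_mem_costValues hg hδ.le (fun t _ => le_rfl) hx
  have ht0 := t.2.1
  have hs1 := s.2.2
  have h1 := hc.sub_le (x := s - t) (y := s) (by linarith) (by linarith) hs1
  rw [sub_sub_cancel, ← hb] at h1
  have h2 := hc.marginal_mul_le (x := s - t) (by linarith) (by linarith)
  rw [← ha] at h2 hle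
  have hε1 : min 1 ((δ - 1) * a / b) ≤ 1 := min_le_left _ _
  have hεb : min 1 ((δ - 1) * a / b) * b ≤ (δ - 1) * a := by
    rw [← le_div_iff₀ hb0]
    exact min_le_right _ _
  generalize min 1 ((δ - 1) * a / b) = ε at hε0 hε1 hεb ⊢
  have h3 : ε * (c s - a * s) ≤ ε * (c (s - t) - a * (s - t)) + ε * b * t := by
    have h4 : 0 ≤ a * t := by positivity
    have : c s - a * s ≤ (c (s - t) - a * (s - t)) + b * t := by linarith
    have := mul_le_mul_of_nonneg_left this hε0.le
    linarith
  have h5 : ε * (c (s - t) - a * (s - t)) ≤ 1 * (c (s - t) - a * (s - t)) :=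
    mul_le_mul_of_nonneg_right hε1 (by linarith)
  have h6 := mul_le_mul_of_nonneg_right hεb ht0
  linarith

/-- Iterates of the operator approach each other geometrically. -/
theorem exists_abs_stochT_iterate_sub_le (hc : CostAssumption c) (hg : TransactionAssumption g)
    (hδ : 1 < δ) : ∃ ρ : ℝ, 0 ≤ ρ ∧ ρ < 1 ∧ ∀ p q : I → ℝ, Admissible c p → Admissible c q →
      ∀ (n : ℕ) (s : I), |(stochT c g δ)^[n] p s - (stochT c g δ)^[n] q s| ≤ ρ ^ n * c 1 := by
  obtain ⟨ε, hε0, hε1, hε⟩ := exists_lower_add_le_stochT hc hg hδ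
  have hδ0 : 0 ≤ δ := zero_le_one.trans hδ.le
  have hρ0 : 0 ≤ 1 - ε := sub_nonneg.2 hε1
  have hρ1 : 1 - ε < 1 := by linarith
  set a := derivWithin c (Icc 0 1) 0 with ha
  refine ⟨1 - ε, hρ0, hρ1, ?_⟩
  -- Induction step, with z = (1 - ε)^n: apply T to the hypothesis, split by concavity, and lift z
  -- u₀ to z (u₀ + ε (v₀ - u₀)). Then v₀ ≥ T^(n+1) p moves the weight z ε over to T^(n+1) p.
  have key : ∀ p q : I → ℝ, Admissible c p → Admissible c q → ∀ (n : ℕ) (s : I),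
      (1 - (1 - ε) ^ n) * (stochT c g δ)^[n] p s + (1 - (1 - (1 - ε) ^ n)) * (a * s) ≤
        (stochT c g δ)^[n] q s := by
    intro p q hp hq n
    induction n with
    | zero => intro s; simpa using hq.lower s
    | succ n ih =>
      intro s
      have hp' := hp.stochT_iterate hc hg hδ n
      have hq' := hq.stochT_iterate hc hg hδ n
      have hτ0 : 0 ≤ 1 - (1 - ε) ^ n := sub_nonneg.2 (pow_le_one₀ hρ0 hρ1.le)
      have hτ1 : 1 - (1 - ε) ^ n ≤ 1 := sub_le_self _ (pow_nonneg hρ0 n)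
      have h1 := stochT_mono hc hg hδ0
        (hp'.convex_comb (admissible_lower hc) hτ0 hτ1) hq' ih s
      have h2 := stochT_concave hc hg hδ0 hp' (admissible_lower hc) hτ0 hτ1 s
      have h3 := mul_le_mul_of_nonneg_left (hε s) (sub_nonneg.2 hτ1)
      have h4 := (hp'.stochT hc hg hδ).upper s
      have h5 := mul_le_mul_of_nonneg_left h4 (mul_nonneg (pow_nonneg hρ0 n) hε0.le)
      rw [Function.iterate_succ_apply', Function.iterate_succ_apply', pow_succ]
      generalize (1 - ε) ^ n = z at *
      refine le_trans ?_ (h2.trans h1)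
      linarith
  have one_side : ∀ p q : I → ℝ, Admissible c p → Admissible c q → ∀ (n : ℕ) (s : I),
      (stochT c g δ)^[n] p s - (stochT c g δ)^[n] q s ≤ (1 - ε) ^ n * c 1 := by
    intro p q hp hq n s
    have h1 := key p q hp hq n s
    have h2 := mul_le_mul_of_nonneg_left ((hp.stochT_iterate hc hg hδ n).le_cost_one hc s)
      (pow_nonneg hρ0 n)
    have h3 : 0 ≤ (1 - ε) ^ n * (a * s) :=
      mul_nonneg (pow_nonneg hρ0 n) (mul_nonneg hc.deriv_zero_pos.le s.2.1)
    linarith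
  intro p q hp hq n s
  rw [abs_le]
  have h1 := one_side p q hp hq n s
  have h2 := one_side q p hq hp n s
  constructor <;> linarith

theorem eq_zero_of_abs_le_geometric {x ρ C : ℝ} (h0 : 0 ≤ ρ) (h1 : ρ < 1)
    (h : ∀ n : ℕ, |x| ≤ ρ ^ n * C) : x = 0 := by
  have ht : Tendsto (fun n : ℕ => ρ ^ n * C) atTop (𝓝 0) := by
    simpa using (tendsto_pow_atTop_nhds_zero_of_lt_one h0 h1).mul_const C
  exact abs_eq_zero.1 (le_antisymm (ge_of_tendsto' ht h) (abs_nonneg _))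

theorem tendstoUniformly_of_abs_sub_le {F : ℕ → I → ℝ} {f : I → ℝ} {b : ℕ → ℝ}
    (hb : Tendsto b atTop (𝓝 0)) (h : ∀ n s, |F n s - f s| ≤ b n) :
    TendstoUniformly F f atTop := by
  refine Metric.tendstoUniformly_iff.2 fun ε hε => ?_
  filter_upwards [hb.eventually_lt_const hε] with n hn s
  rw [dist_comm, Real.dist_eq]
  exact (h n s).trans_lt hn

/-- The operator has a fixed point in the order interval. -/
theorem exists_fixedPoint (hc : CostAssumption c) (hg : TransactionAssumption g)
    (hδ : 1 < δ) : ∃ f : I → ℝ, Admissible c f ∧ stochT c g δ f = f := by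
  obtain ⟨ρ, hρ0, hρ1, H⟩ := exists_abs_stochT_iterate_sub_le hc hg hδ
  have hv := admissible_upper hc
  have hu := admissible_lower hc
  set v : ℕ → I → ℝ := fun n => (stochT c g δ)^[n] fun x => c x with hvdef
  set u : ℕ → I → ℝ := fun n => (stochT c g δ)^[n] fun x => derivWithin c (Icc 0 1) 0 * x with hudef
  have hva : ∀ n, Admissible c (v n) := hv.stochT_iterate hc hg hδ
  have hua : ∀ n, Admissible c (u n) := hu.stochT_iterate hc hg hδ
  have hvadd : ∀ n i, v (n + i) = (stochT c g δ)^[n] (v i) := fun n i =>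
    Function.iterate_add_apply _ _ _ _
  have hupper : ∀ n i s, v (n + i) s ≤ v n s := fun n i => by
    rw [hvadd]
    exact stochT_iterate_mono hc hg hδ (hva i) hv (hva i).upper n
  have hlower : ∀ n i s, u n s ≤ v (n + i) s := fun n i => by
    rw [hvadd]
    exact stochT_iterate_mono hc hg hδ hu (hva i) (hva i).lower n
  have hanti : ∀ s, Antitone fun n => v n s := fun s =>
    antitone_nat_of_succ_le fun n => hupper n 1 s
  have hlim : ∀ s, ∃ y, Tendsto (fun n => v n s) atTop (𝓝 y) := fun s =>
    ⟨_, tendsto_atTop_ciInf (hanti s) ⟨0, by rintro _ ⟨n, rfl⟩; exact (hva n).nonneg hc s⟩⟩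
  choose f hf using hlim
  have hfv : ∀ n s, f s ≤ v n s := fun n s =>
    le_of_tendsto ((tendsto_add_atTop_iff_nat n).2 (hf s))
      (Eventually.of_forall fun i => by rw [add_comm]; exact hupper n i s)
  have huf : ∀ n s, u n s ≤ f s := fun n s =>
    ge_of_tendsto ((tendsto_add_atTop_iff_nat n).2 (hf s))
      (Eventually.of_forall fun i => by rw [add_comm]; exact hlower n i s)
  have hunif : TendstoUniformly v f atTop := by
    refine tendstoUniformly_of_abs_sub_le (b := fun n => ρ ^ n * c 1) ?_ fun n s => ?_
    · simpa using (tendsto_pow_atTop_nhds_zero_of_lt_one hρ0 hρ1).mul_const (c 1)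
    · have h1 := hfv n s
      have h2 := huf n s
      have h3 := (le_abs_self _).trans (H _ _ hv hu n s)
      rw [abs_of_nonneg (sub_nonneg.2 h1)]
      simp only [hvdef, hudef] at h2 ⊢
      linarith
  have hfa : Admissible c f :=
    ⟨hunif.continuous (Frequently.of_forall fun n => (hva n).continuous),
      fun s => huf 0 s, fun s => hfv 0 s⟩
  -- From u n ≤ f ≤ v n and monotonicity, f and its image both lie between u (n + 1) and v (n + 1),
  -- whose gap is at most ρ^(n+1) c(1).
  refine ⟨f, hfa, funext fun s => sub_eq_zero.1
    (eq_zero_of_abs_le_geometric (C := ρ * c 1) hρ0 hρ1 fun n => ?_)⟩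
  have hδ0 : 0 ≤ δ := zero_le_one.trans hδ.le
  have h1 := stochT_mono hc hg hδ0 hfa (hva n) (hfv n) s
  have h2 := stochT_mono hc hg hδ0 (hua n) hfa (huf n) s
  have h3 := hfv (n + 1) s
  have h4 := huf (n + 1) s
  have h5 := (le_abs_self _).trans (H _ _ hv hu (n + 1) s)
  simp only [hvdef, hudef, Function.iterate_succ_apply'] at h1 h2 h3 h4 h5
  rw [pow_succ] at h5
  rw [abs_le]
  constructor <;> linarith

end

/-! ### The grid algorithm -/

section Grid

variable {c : ℝ → ℝ} {g : ℕ+ → ℝ} {δ : ℝ} {p q : I → ℝ} {m j : ℕ}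

theorem coe_gridPoint (hm : 0 < m) (hj : j ≤ m) : (gridPoint m j : ℝ) = (j : ℝ) / m := by
  have hm' : (0 : ℝ) < m := Nat.cast_pos.2 hm
  rw [gridPoint, projIcc_of_mem zero_le_one
    ⟨by positivity, (div_le_one hm').2 (Nat.cast_le.2 hj)⟩]

theorem gridPoint_zero : gridPoint m 0 = 0 := by
  simp [gridPoint]

theorem gridPoint_eq_of_coe_eq {x : I} (hx : (x : ℝ) = (j : ℝ) / m) : gridPoint m j = x := by
  rw [gridPoint, ← hx, projIcc_val]

theorem exists_cell (hm : 0 < m) (x : I) :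
    ∃ j < m, (j : ℝ) / m ≤ x ∧ (x : ℝ) ≤ ((j : ℝ) + 1) / m := by
  have hm' : (0 : ℝ) < m := Nat.cast_pos.2 hm
  have hx0 : 0 ≤ (x : ℝ) * m := mul_nonneg x.2.1 hm'.le
  simp only [div_le_iff₀ hm', le_div_iff₀ hm']
  -- The point x = 1 belongs to the last cell; the floor would give the index m, which is out of
  -- range.
  rcases x.2.2.eq_or_lt with hx | hx
  · refine ⟨m - 1, by omega, ?_, ?_⟩ <;> rw [hx, Nat.cast_sub hm] <;> simp
  · refine ⟨⌊(x : ℝ) * m⌋₊, (Nat.floor_lt hx0).2 ?_, Nat.floor_le hx0,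
      (Nat.lt_floor_add_one _).le⟩
    exact mul_lt_of_lt_one_left hm' hx

theorem continuous_algState (hm : 0 < m) (j : ℕ) : Continuous (algState c g δ m j) := by
  induction j with
  | zero => exact continuous_const
  | succ j ih =>
    simp only [algState]
    refine Continuous.if_le ih (by fun_prop) continuous_subtype_val continuous_const
      fun x hx => ?_
    have hm' : (m : ℝ) ≠ 0 := Nat.cast_ne_zero.2 hm.ne'
    rw [gridPoint_eq_of_coe_eq hx, hx, div_mul_cancel₀ _ hm', sub_self, zero_mul, add_zero]

theorem algState_succ_of_le {x : I} (hx : (x : ℝ) ≤ (j : ℝ) / m) :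
    algState c g δ m (j + 1) x = algState c g δ m j x :=
  if_pos hx

theorem algState_succ_of_lt {x : I} (hx : (j : ℝ) / m < x) :
    algState c g δ m (j + 1) x = algState c g δ m j (gridPoint m j) + ((x : ℝ) * m - j) *
      (sInf (costValues c g δ (algState c g δ m j) (((j : ℝ) + 1) / m) ((j : ℝ) / m)) -
        algState c g δ m j (gridPoint m j)) :=
  if_neg (not_le.2 hx)

theorem algState_eq_of_le {i : ℕ} (hji : j ≤ i) {x : I} (hx : (x : ℝ) ≤ (j : ℝ) / m) :
    algState c g δ m i x = algState c g δ m j x := by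
  induction i, hji using Nat.le_induction with
  | base => rfl
  | succ i hji ih =>
    have h : (x : ℝ) ≤ (i : ℝ) / m :=
      hx.trans (div_le_div_of_nonneg_right (Nat.cast_le.2 hji) (Nat.cast_nonneg _))
    rw [algState_succ_of_le h, ih]

theorem gridAlgorithm_eq_algState (hj : j ≤ m) {x : I} (hx : (x : ℝ) ≤ (j : ℝ) / m) :
    gridAlgorithm c g δ m x = algState c g δ m j x :=
  algState_eq_of_le hj hx

theorem continuous_gridAlgorithm (hm : 0 < m) : Continuous (gridAlgorithm c g δ m) :=
  continuous_algState hm m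

theorem gridAlgorithm_zero : gridAlgorithm c g δ m 0 = 0 := by
  rw [gridAlgorithm_eq_algState (Nat.zero_le m) (by simp)]
  rfl

theorem gridAlgorithm_gridPoint_succ (hj : j < m) :
    gridAlgorithm c g δ m (gridPoint m (j + 1)) =
      sInf (costValues c g δ (gridAlgorithm c g δ m) (gridPoint m (j + 1)) (gridPoint m j)) := by
  have hm : 0 < m := j.zero_le.trans_lt hj
  have hm' : (0 : ℝ) < m := Nat.cast_pos.2 hm
  have h1 : (gridPoint m (j + 1) : ℝ) = ((j : ℝ) + 1) / m := by
    rw [coe_gridPoint hm hj]; push_cast; rfl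
  have hlt : (j : ℝ) / m < gridPoint m (j + 1) := by
    rw [h1]
    exact div_lt_div_of_pos_right (lt_add_one _) hm'
  rw [gridAlgorithm_eq_algState (j := j + 1) hj (coe_gridPoint hm hj).le,
    algState_succ_of_lt hlt, h1, div_mul_cancel₀ _ hm'.ne', add_sub_cancel_left, one_mul,
    add_sub_cancel, coe_gridPoint hm hj.le]
  congr 1
  exact costValues_congr fun t ht => (gridAlgorithm_eq_algState hj.le ht).symm

theorem gridAlgorithm_eq_interpolation (hj : j < m) {x : I} (hx : (j : ℝ) / m ≤ x)
    (hx' : (x : ℝ) ≤ ((j : ℝ) + 1) / m) :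
    gridAlgorithm c g δ m x = (1 - ((x : ℝ) * m - j)) * gridAlgorithm c g δ m (gridPoint m j) +
      ((x : ℝ) * m - j) * gridAlgorithm c g δ m (gridPoint m (j + 1)) := by
  have hm : 0 < m := j.zero_le.trans_lt hj
  have hm' : (0 : ℝ) < m := Nat.cast_pos.2 hm
  -- At the left end point the definition branches to the earlier pass, so the interpolation formula
  -- is checked there separately.
  rcases hx.eq_or_lt with h | h
  · rw [gridPoint_eq_of_coe_eq h.symm, ← h, div_mul_cancel₀ _ hm'.ne', sub_self]
    ring
  have h1 : (gridPoint m (j + 1) : ℝ) = ((j : ℝ) + 1) / m := by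
    rw [coe_gridPoint hm hj]; push_cast; rfl
  have hlt : (j : ℝ) / m < gridPoint m (j + 1) := by
    rw [h1]
    exact div_lt_div_of_pos_right (lt_add_one _) hm'
  rw [gridAlgorithm_eq_algState (j := j + 1) hj (coe_gridPoint hm hj).le,
    gridAlgorithm_eq_algState hj.le (coe_gridPoint hm hj.le).le,
    gridAlgorithm_eq_algState (j := j + 1) hj (by push_cast; exact hx'),
    algState_succ_of_lt h, algState_succ_of_lt hlt, h1, div_mul_cancel₀ _ hm'.ne']
  ring

theorem coe_eq_interpolation (hj : j < m) (x : I) :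
    (x : ℝ) = (1 - ((x : ℝ) * m - j)) * gridPoint m j +
      ((x : ℝ) * m - j) * gridPoint m (j + 1) := by
  have hm : 0 < m := j.zero_le.trans_lt hj
  have hm' : (0 : ℝ) < m := Nat.cast_pos.2 hm
  rw [coe_gridPoint hm hj, coe_gridPoint hm hj.le]
  push_cast
  field_simp
  ring

theorem interpolation_weight_mem (hm : 0 < m) {x : I} (hx : (j : ℝ) / m ≤ x)
    (hx' : (x : ℝ) ≤ ((j : ℝ) + 1) / m) :
    0 ≤ (x : ℝ) * m - j ∧ 0 ≤ 1 - ((x : ℝ) * m - j) := by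
  have hm' : (0 : ℝ) < m := Nat.cast_pos.2 hm
  rw [div_le_iff₀ hm'] at hx
  rw [le_div_iff₀ hm'] at hx'
  constructor <;> linarith

/-- The new grid value uses prices on [0, j/m] only, so the linear bound already proved there passes
to it; linear interpolation preserves a linear bound. -/
theorem lower_le_gridAlgorithm (hc : CostAssumption c) (hg : TransactionAssumption g)
    (hδ : 1 ≤ δ) (hm : 0 < m) (x : I) :
    derivWithin c (Icc 0 1) 0 * x ≤ gridAlgorithm c g δ m x := by
  have hm' : (0 : ℝ) < m := Nat.cast_pos.2 hm
  suffices h : ∀ j ≤ m, ∀ x : I, (x : ℝ) ≤ (j : ℝ) / m →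
      derivWithin c (Icc 0 1) 0 * x ≤ gridAlgorithm c g δ m x from
    h m le_rfl x (by rw [div_self hm'.ne']; exact x.2.2)
  intro j
  induction j with
  | zero =>
    intro _ x hx
    have hx0 : x = 0 := Subtype.ext (le_antisymm (by simpa using hx) x.2.1)
    simp [hx0, gridAlgorithm_zero]
  | succ j ih =>
    intro hj x hx
    have ih := ih (Nat.le_of_succ_le hj)
    rcases le_total (x : ℝ) ((j : ℝ) / m) with h | h
    · exact ih x h
    push_cast at hx
    have hgp := coe_gridPoint hm (Nat.le_of_succ_le hj)
    obtain ⟨hw0, hw1⟩ := interpolation_weight_mem hm h hx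
    have h0 := ih (gridPoint m j) hgp.le
    have h1 : derivWithin c (Icc 0 1) 0 * gridPoint m (j + 1) ≤
        gridAlgorithm c g δ m (gridPoint m (j + 1)) := by
      rw [gridAlgorithm_gridPoint_succ hj]
      refine le_csInf ⟨_, zero_mem_costValues hg (gridPoint m j).2.1⟩ fun y hy => ?_
      refine lower_le_of_mem_costValues hc hg hδ ?_ (gridPoint m (j + 1)).2.2
        (fun t ht => ih t (ht.trans hgp.le)) hy
      rw [hgp, coe_gridPoint hm hj]
      exact div_le_div_of_nonneg_right (Nat.cast_le.2 j.le_succ) hm'.le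
    have e := coe_eq_interpolation hj x
    rw [gridAlgorithm_eq_interpolation hj h hx]
    have h2 := mul_le_mul_of_nonneg_left h0 hw1
    have h3 := mul_le_mul_of_nonneg_left h1 hw0
    calc derivWithin c (Icc 0 1) 0 * x
        = (1 - ((x : ℝ) * m - j)) * (derivWithin c (Icc 0 1) 0 * gridPoint m j) +
          ((x : ℝ) * m - j) * (derivWithin c (Icc 0 1) 0 * gridPoint m (j + 1)) := by
          conv_lhs => rw [e]
          ring
      _ ≤ _ := add_le_add h2 h3

theorem gridAlgorithm_nonneg (hc : CostAssumption c) (hg : TransactionAssumption g)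
    (hδ : 1 ≤ δ) (hm : 0 < m) (x : I) : 0 ≤ gridAlgorithm c g δ m x :=
  (mul_nonneg hc.deriv_zero_pos.le x.2.1).trans (lower_le_gridAlgorithm hc hg hδ hm x)

theorem gridPoint_le_succ (hj : j < m) : (gridPoint m j : ℝ) ≤ gridPoint m (j + 1) := by
  have hm : 0 < m := j.zero_le.trans_lt hj
  rw [coe_gridPoint hm hj.le, coe_gridPoint hm hj]
  exact div_le_div_of_nonneg_right (Nat.cast_le.2 j.le_succ) (Nat.cast_nonneg _)

theorem isLeast_gridAlgorithm (hc : CostAssumption c) (hg : TransactionAssumption g)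
    (hδ : 1 ≤ δ) (hj : j < m) :
    IsLeast (costValues c g δ (gridAlgorithm c g δ m) (gridPoint m (j + 1)) (gridPoint m j))
      (gridAlgorithm c g δ m (gridPoint m (j + 1))) := by
  have hm : 0 < m := j.zero_le.trans_lt hj
  rw [gridAlgorithm_gridPoint_succ hj]
  exact isLeast_sInf_costValues hc hg (zero_le_one.trans hδ) (continuous_gridAlgorithm hm)
    (gridAlgorithm_nonneg hc hg hδ hm) (gridPoint m j).2.1 (gridPoint_le_succ hj)
    (gridPoint m (j + 1)).2.2

theorem gridAlgorithm_gridPoint_le_cost (hc : CostAssumption c) (hg : TransactionAssumption g)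
    (hδ : 1 ≤ δ) (hj : j ≤ m) : gridAlgorithm c g δ m (gridPoint m j) ≤ c (gridPoint m j) := by
  cases j with
  | zero => simp [gridPoint_zero, gridAlgorithm_zero, hc.map_zero]
  | succ j =>
    simpa [gridAlgorithm_zero] using (isLeast_gridAlgorithm hc hg hδ hj).2
      (zero_mem_costValues hg (gridPoint m j).2.1)

/-- Piecewise linear interpolation of an admissible function has small relative error. -/
theorem Admissible.eventually_interpolation (hc : CostAssumption c) (hp : Admissible c p) {ε : ℝ}
    (hε : 0 < ε) : ∀ᶠ m : ℕ in atTop, ∀ j < m, ∀ x : I, (j : ℝ) / m ≤ x →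
      (x : ℝ) ≤ ((j : ℝ) + 1) / m →
      (1 - ((x : ℝ) * m - j)) * p (gridPoint m j) + ((x : ℝ) * m - j) * p (gridPoint m (j + 1)) ≤
        (1 + ε) * p x ∧
      p x ≤ (1 + ε) * ((1 - ((x : ℝ) * m - j)) * p (gridPoint m j) +
        ((x : ℝ) * m - j) * p (gridPoint m (j + 1))) := by
  obtain ⟨avg, havgc, -, -, havg⟩ := hp.exists_average hc
  set a := derivWithin c (Icc 0 1) 0 with ha
  have ha0 : 0 < a := hc.deriv_zero_pos
  have hcont := CompactSpace.uniformContinuous_of_continuous havgc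
  -- The interpolant is a weighted mean of y · avg y at points y whose mean is x. A tolerance ε a on
  -- avg gives an error of at most ε a x, which is at most ε p x, and likewise at most ε times the
  -- interpolant.
  obtain ⟨d, hd, hdavg⟩ := Metric.uniformContinuous_iff.1 hcont (ε * a) (by positivity)
  filter_upwards [tendsto_one_div_atTop_nhds_zero_nat.eventually_lt_const hd] with m hmd j hj x
    hx hx'
  have hm : 0 < m := j.zero_le.trans_lt hj
  have hm' : (0 : ℝ) < m := Nat.cast_pos.2 hm
  obtain ⟨hw0, hw1⟩ := interpolation_weight_mem hm hx hx'
  have e := coe_eq_interpolation hj x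
  have h0 := coe_gridPoint hm hj.le
  have h1 := coe_gridPoint hm (Nat.succ_le_of_lt hj)
  push_cast at h1
  have hstep : ((j : ℝ) + 1) / m = (j : ℝ) / m + 1 / m := add_div _ _ _
  have hclose : ∀ y : I, |(y : ℝ) - x| ≤ 1 / m → |avg y - avg x| ≤ ε * a := fun y hy => by
    have := hdavg (a := y) (b := x) (by
      rw [Subtype.dist_eq, Real.dist_eq]
      exact hy.trans_lt hmd)
    rw [Real.dist_eq] at this
    exact this.le
  have hd0 := abs_le.1 (hclose (gridPoint m j) (by rw [h0, abs_le]; constructor <;> linarith))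
  have hd1 := abs_le.1 (hclose (gridPoint m (j + 1))
    (by rw [h1, abs_le]; constructor <;> linarith))
  have hlow0 := hp.lower (gridPoint m j)
  have hlow1 := hp.lower (gridPoint m (j + 1))
  have hlow := hp.lower x
  rw [← ha] at hlow hlow0 hlow1
  rw [havg] at hlow hlow0 hlow1
  rw [havg x, havg (gridPoint m j), havg (gridPoint m (j + 1))]
  have hy0 := (gridPoint m j).2.1
  have hy1 := (gridPoint m (j + 1)).2.1
  generalize (x : ℝ) * m - j = w at *
  generalize ((gridPoint m j : I) : ℝ) = y₀ at *
  generalize ((gridPoint m (j + 1) : I) : ℝ) = y₁ at *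
  generalize avg (gridPoint m j) = b₀ at *
  generalize avg (gridPoint m (j + 1)) = b₁ at *
  generalize avg x = b at *
  generalize (x : ℝ) = z at *
  have hz0 : 0 ≤ (1 - w) * y₀ := mul_nonneg hw1 hy0
  have hz1 : 0 ≤ w * y₁ := mul_nonneg hw0 hy1
  have k1 := mul_le_mul_of_nonneg_left hd0.1 hz0
  have k2 := mul_le_mul_of_nonneg_left hd0.2 hz0
  have k3 := mul_le_mul_of_nonneg_left hd1.1 hz1
  have k4 := mul_le_mul_of_nonneg_left hd1.2 hz1
  have k5 := mul_le_mul_of_nonneg_left hlow0 hw1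
  have k6 := mul_le_mul_of_nonneg_left hlow1 hw0
  have ez : z * b = ((1 - w) * y₀ + w * y₁) * b := by rw [← e]
  have ea : a * z = a * ((1 - w) * y₀ + w * y₁) := by rw [← e]
  constructor
  · have k7 := mul_le_mul_of_nonneg_left hlow hε.le
    have k8 : ε * (a * z) = ε * (a * ((1 - w) * y₀ + w * y₁)) := by rw [← e]
    linarith
  · have k7 : a * ((1 - w) * y₀ + w * y₁) ≤ (1 - w) * (y₀ * b₀) + w * (y₁ * b₁) := by linarith
    have k8 := mul_le_mul_of_nonneg_left k7 hε.le
    linarith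

theorem Admissible.eventually_gridAlgorithm_le (hc : CostAssumption c) (hp : Admissible c p)
    {ε : ℝ} (hε : 0 < ε) : ∀ᶠ m : ℕ in atTop, ∀ A : ℝ, 0 ≤ A →
      (∀ j ≤ m, gridAlgorithm c g δ m (gridPoint m j) ≤ A * p (gridPoint m j)) →
      ∀ x, gridAlgorithm c g δ m x ≤ A * ((1 + ε) * p x) := by
  filter_upwards [hp.eventually_interpolation hc hε, eventually_gt_atTop 0] with m h hm A hA H x
  obtain ⟨j, hj, hx, hx'⟩ := exists_cell hm x
  obtain ⟨hw0, hw1⟩ := interpolation_weight_mem hm hx hx'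
  rw [gridAlgorithm_eq_interpolation hj hx hx']
  have h1 := mul_le_mul_of_nonneg_left (H j hj.le) hw1
  have h2 := mul_le_mul_of_nonneg_left (H (j + 1) hj) hw0
  have h3 := mul_le_mul_of_nonneg_left (h j hj x hx hx').1 hA
  linarith

theorem Admissible.eventually_le_gridAlgorithm (hc : CostAssumption c) (hp : Admissible c p)
    {ε : ℝ} (hε : 0 < ε) : ∀ᶠ m : ℕ in atTop, ∀ A : ℝ,
      (∀ j ≤ m, p (gridPoint m j) ≤ A * gridAlgorithm c g δ m (gridPoint m j)) →
      ∀ x, p x ≤ (1 + ε) * (A * gridAlgorithm c g δ m x) := by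
  filter_upwards [hp.eventually_interpolation hc hε, eventually_gt_atTop 0] with m h hm A H x
  obtain ⟨j, hj, hx, hx'⟩ := exists_cell hm x
  obtain ⟨hw0, hw1⟩ := interpolation_weight_mem hm hx hx'
  rw [gridAlgorithm_eq_interpolation hj hx hx']
  have h1 := mul_le_mul_of_nonneg_left (H j hj.le) hw1
  have h2 := mul_le_mul_of_nonneg_left (H (j + 1) hj) hw0
  refine (h j hj x hx hx').2.trans (mul_le_mul_of_nonneg_left ?_ (by linarith))
  linarith

/-! ### Relative bounds for the grid algorithm -/

/-- Up to a factor tending to `1`, the output of the grid algorithm is at most `p`. -/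
def GridUpperBound (c : ℝ → ℝ) (g : ℕ+ → ℝ) (δ : ℝ) (p : I → ℝ) : Prop :=
  ∀ η > 0, ∀ᶠ m : ℕ in atTop, ∀ x, gridAlgorithm c g δ m x ≤ (1 + η) * p x

/-- Up to a factor tending to `1`, the output of the grid algorithm is at least `p`. -/
def GridLowerBound (c : ℝ → ℝ) (g : ℕ+ → ℝ) (δ : ℝ) (p : I → ℝ) : Prop :=
  ∀ η > 0, ∀ᶠ m : ℕ in atTop, ∀ x, p x ≤ (1 + η) * gridAlgorithm c g δ m x

theorem exists_one_add_mul_self_le {η : ℝ} (hη : 0 < η) :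
    ∃ ζ > 0, (1 + 2 * ζ) * (1 + ζ) ≤ 1 + η := by
  -- For ζ ≤ 1 the product is 1 + 3ζ + 2ζ² ≤ 1 + 5ζ.
  refine ⟨min 1 (η / 5), lt_min one_pos (by positivity), ?_⟩
  have h0 : 0 < min 1 (η / 5) := lt_min one_pos (by positivity)
  have h1 : min 1 (η / 5) ≤ 1 := min_le_left _ _
  have h2 : min 1 (η / 5) ≤ η / 5 := min_le_right _ _
  nlinarith

theorem gridUpperBound_of_gridPoint (hc : CostAssumption c) (hp : Admissible c p)
    (h : ∀ ζ > 0, ∀ᶠ m : ℕ in atTop, ∀ j ≤ m,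
      gridAlgorithm c g δ m (gridPoint m j) ≤ (1 + 2 * ζ) * p (gridPoint m j)) :
    GridUpperBound c g δ p := by
  intro η hη
  obtain ⟨ζ, hζ, hle⟩ := exists_one_add_mul_self_le hη
  filter_upwards [h ζ hζ, hp.eventually_gridAlgorithm_le hc hζ] with m h1 h2 x
  refine (h2 _ (by positivity) h1 x).trans ?_
  have := mul_le_mul_of_nonneg_right hle (hp.nonneg hc x)
  linarith

theorem gridUpperBound_cost (hc : CostAssumption c) (hg : TransactionAssumption g) (hδ : 1 ≤ δ) :
    GridUpperBound c g δ fun x => c x :=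
  gridUpperBound_of_gridPoint hc (admissible_upper hc) fun ζ hζ =>
    Eventually.of_forall fun m j hj => by
      have h1 := gridAlgorithm_gridPoint_le_cost hc hg hδ hj
      have h2 := hc.nonneg (gridPoint m j).2.1 (gridPoint m j).2.2
      nlinarith

/-- Near 0 the two ends of the order interval agree up to a factor close to 1, so the grid bound
there needs no optimization. -/
theorem CostAssumption.exists_le_mul_marginal (hc : CostAssumption c) {ζ : ℝ} (hζ : 0 < ζ) :
    ∃ s₀ > 0, ∀ s : ℝ, 0 ≤ s → s ≤ 1 → s < s₀ →
      c s ≤ (1 + ζ) * (derivWithin c (Icc 0 1) 0 * s) := by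
  have ha := hc.deriv_zero_pos
  have h := hc.tendsto_div.eventually_lt_const
    (show derivWithin c (Icc 0 1) 0 < (1 + ζ) * derivWithin c (Icc 0 1) 0 by nlinarith)
  obtain ⟨s₀, hs₀, H⟩ := Metric.mem_nhdsWithin_iff.1 h
  refine ⟨s₀, hs₀, fun s h0 h1 hs => ?_⟩
  rcases h0.eq_or_lt with rfl | h0
  · simp [hc.map_zero]
  have := H ⟨by simpa [abs_of_pos h0] using hs, h0, h1⟩
  have h2 : c s / s < (1 + ζ) * derivWithin c (Icc 0 1) 0 := this
  rw [div_lt_iff₀ h0] at h2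
  linarith

theorem CostAssumption.tendsto_one_div (hc : CostAssumption c) :
    Tendsto (fun m : ℕ => c (1 / m)) atTop (𝓝 0) := by
  have h := (hc.continuousOn 0 (by simp)).tendsto
  rw [hc.map_zero] at h
  refine h.comp (tendsto_nhdsWithin_iff.2 ⟨tendsto_one_div_atTop_nhds_zero_nat, ?_⟩)
  filter_upwards [eventually_gt_atTop 0] with m hm
  exact ⟨by positivity, (div_le_one (Nat.cast_pos.2 hm)).2 (Nat.one_le_cast.2 hm)⟩

/-- The algorithm may use only t ≤ s - h. If the optimal t for s is larger, lowering it to s - h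
costs at most c(h) more, and monotonicity of p keeps the other prices under control. For s ≥ s₀ this
is a small relative error because the image of p is at least c'(0) s₀ there. One ζ of the factor 1 +
2ζ comes from the hypothesis, the other from c(h). -/
theorem GridUpperBound.stochT (hc : CostAssumption c) (hg : TransactionAssumption g)
    (hδ : 1 < δ) (hp : Admissible c p) (hm : Monotone p) (h : GridUpperBound c g δ p) :
    GridUpperBound c g δ (stochT c g δ p) := by
  have hδ0 : 0 ≤ δ := zero_le_one.trans hδ.le
  have hTp := hp.stochT hc hg hδ
  refine gridUpperBound_of_gridPoint hc hTp fun ζ hζ => ?_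
  set a := derivWithin c (Icc 0 1) 0 with ha
  have ha0 : 0 < a := hc.deriv_zero_pos
  obtain ⟨s₀, hs₀, hsmall⟩ := hc.exists_le_mul_marginal hζ
  filter_upwards [h ζ hζ, hc.tendsto_one_div.eventually_le_const
    (show 0 < ζ * (a * s₀) by positivity)] with m hup hcm j hj
  rcases lt_or_ge (gridPoint m j : ℝ) s₀ with hs | hs
  · have h1 := gridAlgorithm_gridPoint_le_cost hc hg hδ.le hj
    have h2 := hsmall _ (gridPoint m j).2.1 (gridPoint m j).2.2 hs
    have h3 := mul_le_mul_of_nonneg_left (hTp.lower (gridPoint m j))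
      (show 0 ≤ 1 + ζ by linarith)
    have h4 := mul_nonneg hζ.le (hTp.nonneg hc (gridPoint m j))
    linarith
  cases j with
  | zero =>
    rw [gridPoint_zero] at hs
    exact absurd hs (not_le.2 hs₀)
  | succ j =>
    have hm0 : 0 < m := j.succ_pos.trans_le hj
    have hG := isLeast_gridAlgorithm (δ := δ) hc hg hδ.le hj
    have hGnn := gridAlgorithm_nonneg (δ := δ) hc hg hδ.le hm0
    obtain ⟨t, ht, l, hl, e, he, hval⟩ := (isLeast_stochT hc hg hδ0 hp (gridPoint m (j + 1))).1
    have hcomp : ∀ t' : I, t' ≤ t → ∃ e', HasSum (fun k : ℕ+ =>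
        (g k + δ * (k : ℕ) * gridAlgorithm c g δ m (share t' k)) * shiftedPoisson l k) e' ∧
        e' ≤ (1 + ζ) * e + 0 := fun t' ht' =>
      exists_hasSum_shiftedPoisson_le hl he (payoff_nonneg hg hδ0 hGnn t') fun k => by
        have h1 := (hup (share t' k)).trans
          (mul_le_mul_of_nonneg_left (hm (share_mono ht' k)) (by linarith))
        have h2 := mul_le_mul_of_nonneg_left h1
          (mul_nonneg hδ0 (Nat.cast_nonneg (α := ℝ) (k : ℕ)))
        have h3 := mul_nonneg hζ.le (hg.nonneg k)
        linarith
    have hst := hc.nonneg (x := gridPoint m (j + 1) - t) (sub_nonneg.2 ht)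
      (by have := t.2.1; have := (gridPoint m (j + 1)).2.2; linarith)
    have hζst := mul_nonneg hζ.le hst
    have hTnn := mul_nonneg hζ.le (hTp.nonneg hc (gridPoint m (j + 1)))
    rcases le_total (t : ℝ) (gridPoint m j) with htj | htj
    · obtain ⟨e', he', hle⟩ := hcomp t le_rfl
      have h1 := hG.2 ⟨t, htj, l, hl, e', he', rfl⟩
      have h2 : (1 + ζ) * _root_.stochT c g δ p (gridPoint m (j + 1)) =
        (1 + ζ) * (c (gridPoint m (j + 1) - t) + e) := by rw [hval]
      linarith
    · obtain ⟨e', he', hle⟩ := hcomp (gridPoint m j) htj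
      have h1 := hG.2 ⟨gridPoint m j, le_rfl, l, hl, e', he', rfl⟩
      have h2 : (1 + ζ) * _root_.stochT c g δ p (gridPoint m (j + 1)) =
        (1 + ζ) * (c (gridPoint m (j + 1) - t) + e) := by rw [hval]
      have h3 : (gridPoint m (j + 1) : ℝ) - gridPoint m j = 1 / m := by
        rw [coe_gridPoint hm0 hj, coe_gridPoint hm0 (Nat.le_of_succ_le hj)]
        push_cast
        ring
      rw [h3] at h1
      have h4 : a * s₀ ≤ _root_.stochT c g δ p (gridPoint m (j + 1)) :=
        (mul_le_mul_of_nonneg_left hs ha0.le).trans (hTp.lower _)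
      have h5 := mul_le_mul_of_nonneg_left h4 hζ.le
      linarith

theorem gridLowerBound_lower (hc : CostAssumption c) (hg : TransactionAssumption g) (hδ : 1 ≤ δ) :
    GridLowerBound c g δ fun x => derivWithin c (Icc 0 1) 0 * x := fun η hη => by
  filter_upwards [eventually_gt_atTop 0] with m hm x
  have h1 := lower_le_gridAlgorithm hc hg hδ hm x
  have h2 := mul_nonneg hη.le (gridAlgorithm_nonneg hc hg hδ hm x)
  linarith

/-- Every decision open to the algorithm is feasible for the operator, so no adjustment of t and no
monotonicity is needed. -/
theorem GridLowerBound.stochT (hc : CostAssumption c) (hg : TransactionAssumption g)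
    (hδ : 1 < δ) (hp : Admissible c p) (h : GridLowerBound c g δ p) :
    GridLowerBound c g δ (stochT c g δ p) := by
  have hδ0 : 0 ≤ δ := zero_le_one.trans hδ.le
  have hTp := hp.stochT hc hg hδ
  intro η hη
  obtain ⟨ζ, hζ, hle⟩ := exists_one_add_mul_self_le hη
  filter_upwards [h ζ hζ, hTp.eventually_le_gridAlgorithm (g := g) (δ := δ) hc hζ,
    eventually_gt_atTop 0] with m h1 h2 hm x
  have hGnn := gridAlgorithm_nonneg (δ := δ) hc hg hδ.le hm
  have hgrid : ∀ j ≤ m, _root_.stochT c g δ p (gridPoint m j) ≤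
      (1 + ζ) * gridAlgorithm c g δ m (gridPoint m j) := by
    intro j hj
    cases j with
    | zero => simp [gridPoint_zero, gridAlgorithm_zero, hTp.map_zero hc]
    | succ j =>
      have hs := gridPoint_le_succ (Nat.lt_of_succ_le hj)
      obtain ⟨y, ⟨t, ht, l, hl, e, he, rfl⟩, hy⟩ := exists_mem_costValues_le_mul hc hg hδ0
        (show 1 ≤ 1 + ζ by linarith) (hp.nonneg hc) h1 hs (gridPoint m (j + 1)).2.2
        (isLeast_gridAlgorithm (δ := δ) hc hg hδ.le hj).1
      exact (stochT_le hc hg hδ0 (hp.nonneg hc) ⟨t, ht.trans hs, l, hl, e, he, rfl⟩).trans hy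
  refine (h2 _ hgrid x).trans ?_
  have h3 := mul_le_mul_of_nonneg_right hle (hGnn x)
  have h4 : 0 ≤ ζ * (1 + ζ) * gridAlgorithm c g δ m x := mul_nonneg (by positivity) (hGnn x)
  linarith

/-- The grid algorithm converges to every fixed point of the operator in the order interval. -/
theorem tendstoUniformly_gridAlgorithm (hc : CostAssumption c) (hg : TransactionAssumption g)
    (hδ : 1 < δ) (hp : Admissible c p) (hfix : stochT c g δ p = p) :
    TendstoUniformly (fun m : ℕ => gridAlgorithm c g δ m) p atTop := by
  obtain ⟨ρ, hρ0, hρ1, H⟩ := exists_abs_stochT_iterate_sub_le hc hg hδ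
  have hv := admissible_upper hc
  have hu := admissible_lower hc
  have hup : ∀ n : ℕ, Monotone ((stochT c g δ)^[n] fun x : I => c x) ∧
      GridUpperBound c g δ ((stochT c g δ)^[n] fun x : I => c x) := fun n => by
    induction n with
    | zero => exact ⟨fun x y hxy => hc.mono x.2.1 hxy y.2.2, gridUpperBound_cost hc hg hδ.le⟩
    | succ n ih =>
      rw [Function.iterate_succ_apply']
      have ha := hv.stochT_iterate hc hg hδ n
      exact ⟨monotone_stochT hc hg (zero_le_one.trans hδ.le) ha ih.1,
        ih.2.stochT hc hg hδ ha ih.1⟩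
  have hlow : ∀ n : ℕ, GridLowerBound c g δ
      ((stochT c g δ)^[n] fun x : I => derivWithin c (Icc 0 1) 0 * x) := fun n => by
    induction n with
    | zero => exact gridLowerBound_lower hc hg hδ.le
    | succ n ih =>
      rw [Function.iterate_succ_apply']
      exact ih.stochT hc hg hδ (hu.stochT_iterate hc hg hδ n)
  have hc1 : 0 < c 1 := hc.map_zero ▸ hc.strictMonoOn (by simp) (by simp) zero_lt_one
  have hiter : ∀ n, (stochT c g δ)^[n] p = p := fun n => Function.iterate_fixed hfix n
  refine Metric.tendstoUniformly_iff.2 fun ε hε => ?_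
  have ht : Tendsto (fun n : ℕ => ρ ^ n * c 1) atTop (𝓝 0) := by
    simpa using (tendsto_pow_atTop_nhds_zero_of_lt_one hρ0 hρ1).mul_const (c 1)
  obtain ⟨n, hn⟩ := (ht.eventually_lt_const (half_pos hε)).exists
  -- Half of ε pays for the distance of the n-th iterates from p, the other half for the relative
  -- error η, since the iterates are at most c 1.
  have hη0 : 0 < min 1 (ε / 2 / c 1) := lt_min one_pos (by positivity)
  have hη1 : min 1 (ε / 2 / c 1) ≤ 1 := min_le_left _ _
  have hηc : min 1 (ε / 2 / c 1) * c 1 ≤ ε / 2 := by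
    rw [← le_div_iff₀ hc1]
    exact min_le_right _ _
  filter_upwards [(hup n).2 _ hη0, hlow n _ hη0, eventually_gt_atTop 0] with m h1 h2 hm x
  generalize min 1 (ε / 2 / c 1) = η at *
  have hu1 := H _ _ hu hp n x
  have hv1 := H _ _ hv hp n x
  rw [hiter] at hu1 hv1
  have hun := (hu.stochT_iterate hc hg hδ n).le_cost_one hc x
  have hvn := (hv.stochT_iterate hc hg hδ n).le_cost_one hc x
  have h1 := h1 x
  have h2 := h2 x
  have hG := gridAlgorithm_nonneg (δ := δ) hc hg hδ.le hm x
  have k1 := mul_le_mul_of_nonneg_left hvn hη0.le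
  have k2 := mul_le_mul_of_nonneg_left hun hη0.le
  -- Multiplying by 1 - η turns the lower bound into (1 - η) u ≤ (1 - η²) G ≤ G, with u the iterate
  -- of the lower end and G the grid output.
  have k3 := mul_le_mul_of_nonneg_left h2 (sub_nonneg.2 hη1)
  have k4 : 0 ≤ η * η * gridAlgorithm c g δ m x := by positivity
  rw [Real.dist_eq, abs_lt]
  have hu2 := abs_le.1 hu1
  have hv2 := abs_le.1 hv1
  constructor <;> linarith

end Grid

/-- The first two conjuncts say that the minima defining the operator on the order interval and
the grid algorithm are attained, and that the operator maps the order interval into itself. -/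
theorem theorem4 (c : ℝ → ℝ) (g : ℕ+ → ℝ) (δ : ℝ) (hδ : 1 < δ)
    (hc : CostAssumption c) (hg : TransactionAssumption g) :
    (∀ p ∈ orderInterval c,
      (∀ s : I, IsLeast (costValues c g δ p s s) (stochT c g δ p s)) ∧
      ∃ q ∈ orderInterval c, ⇑q = stochT c g δ p) ∧
    (∀ n j : ℕ, j < 2 ^ n →
      IsLeast (costValues c g δ (gridAlgorithm c g δ (2 ^ n))
          (gridPoint (2 ^ n) (j + 1)) (gridPoint (2 ^ n) j))
        (gridAlgorithm c g δ (2 ^ n) (gridPoint (2 ^ n) (j + 1)))) ∧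
    ∃ pstar ∈ orderInterval c,
      stochT c g δ pstar = pstar ∧
      (∀ q ∈ orderInterval c, stochT c g δ q = q → q = pstar) ∧
      (∀ p ∈ orderInterval c,
        TendstoUniformly (fun n : ℕ => (stochT c g δ)^[n] p) pstar atTop) ∧
      TendstoUniformly (fun n : ℕ => gridAlgorithm c g δ (2 ^ n)) pstar atTop := by
  have hδ0 : 0 ≤ δ := zero_le_one.trans hδ.le
  refine ⟨fun p hp => ?_, fun n j hj => isLeast_gridAlgorithm hc hg hδ.le hj, ?_⟩
  · have hpa := admissible_of_mem_orderInterval hp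
    have hT := hpa.stochT hc hg hδ
    exact ⟨isLeast_stochT hc hg hδ0 hpa,
      ⟨stochT c g δ p, hT.continuous⟩, fun s => ⟨hT.lower s, hT.upper s⟩, rfl⟩
  obtain ⟨f, hf, hfix⟩ := exists_fixedPoint hc hg hδ
  obtain ⟨ρ, hρ0, hρ1, H⟩ := exists_abs_stochT_iterate_sub_le hc hg hδ
  have hiter : ∀ n, (stochT c g δ)^[n] f = f := fun n => Function.iterate_fixed hfix n
  refine ⟨⟨f, hf.continuous⟩, fun s => ⟨hf.lower s, hf.upper s⟩, hfix, fun q hq hqfix => ?_,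
    fun p hp => ?_, ?_⟩
  · ext s
    refine sub_eq_zero.1 (eq_zero_of_abs_le_geometric (C := c 1) hρ0 hρ1 fun n => ?_)
    have h := H q f (admissible_of_mem_orderInterval hq) hf n s
    rwa [hiter, Function.iterate_fixed hqfix] at h
  · refine tendstoUniformly_of_abs_sub_le (b := fun n => ρ ^ n * c 1) ?_ fun n s => ?_
    · simpa using (tendsto_pow_atTop_nhds_zero_of_lt_one hρ0 hρ1).mul_const (c 1)
    · have h := H p f (admissible_of_mem_orderInterval hp) hf n s
      rwa [hiter] at h
  · have h := tendstoUniformly_gridAlgorithm hc hg hδ hf hfix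
    rw [Metric.tendstoUniformly_iff] at h ⊢
    exact fun ε hε => (tendsto_pow_atTop_atTop_of_one_lt one_lt_two).eventually (h ε hε)
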